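/- Let $\Phi_t$ be a flow on $\mathbb R^n$ (with a fixed norm $\|\cdot\|$) that is $C^{1,\alpha}$ in $(t,x)$ for some $\alpha\in(0,1]$, i.e. $C^1$ with locally $\alpha$-Hölder derivative. Let $C\subset\mathbb R^n$ be a $k$-cone, $k\ge 1$: a closed set with $lv\in C$ for all $v\in C$, $l\in\mathbb R$, such that $k$ is the maximal dimension of a linear subspace contained in $C$. Write $x\sim y$ if $x-y\in C$ and $x\approx y$ if $x-y\in\operatorname{Int}C$. Assume that $\Phi_t$ is strongly monotone with respect to $C$, i.e. $x\sim y$ implies $\Phi_t(x)\sim\Phi_t(y)$ for $t\ge 0$, and $x\sim y$, $x\ne y$ imply $\Phi_t(x)\approx\Phi_t(y)$ for $t>0$; and that $D_x\Phi_t(C\setminus\{0\})\subset\operatorname{Int}C$ for all $x$ and all $t>0$. Let $O(x)=\{\Phi_t(x):t\ge0\}$ and $\omega(x)=\bigcap_{s\ge 0}\overline{\{\Phi_t(x):t\ge s\}}$, and let $Q$ be the set of points $x$ with $O(x)\neq\{x\}$ such that $O(x)$ contains two distinct points $p\sim q$. Let $D\subset\mathbb R^n$ be open and $\omega$-compact,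 i.e. $O(y)$ is bounded for each $y\in D$ and $\bigcup_{y\in D}\omega(y)$ is bounded. Let $x\in D$. A $k$-exponential separation along $\omega(x)$ associated with $C$ consists of families of subspaces $(E_z)_{z\in\omega(x)}$ of dimension $k$ and $(F_z)_{z\in\omega(x)}$ of dimension $n-k$, continuous in $z$ for the gap metric (the Hausdorff distance of unit spheres), such that for all $z\in\omega(x)$: $\mathbb R^n=E_z\oplus F_z$; $D_z\Phi_tE_z=E_{\Phi_t(z)}$ and $D_z\Phi_tF_z\subset F_{\Phi_t(z)}$ for $t>0$; $E_z\subset\operatorname{Int}C\cup\{0\}$ and $F_z\cap C=\{0\}$; and there are $M>0$ and $0<\gamma<1$, independent of $z$, with $\|D_z\Phi_tw\|\le M\gamma^t\|D_z\Phi_tv\|$ for all $t\ge0$ and unit vectors $w\in F_z$, $v\in E_z$. Given such a separation, put, for $z\in\omega(x)$, $$\lambda_{kz}=\limsup_{t\to+\infty}\frac{\log m(D_z\Phi_t|_{E_z})}{t},\qquad m(D_z\Phi_t|_{E_z})=\inf_{v\in E_z,\ \|v\|=1}\|D_z\Phi_tv\|,$$ and call $z$ regular if this upper limit is a limit, irregular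 otherwise. Then a $k$-exponential separation along $\omega(x)$ associated with $C$ exists, and for every such separation the following holds: if $\lambda_{kz}>0$ for every regular point $z\in\omega(x)$, and there is an irregular point $z\in\omega(x)$ with $\lambda_{kz}\le0$, then $x\in\overline{Q}$. -/

import Mathlib

open Filter Topology
open scoped NNReal

noncomputable section

namespace ConeFlow

variable {V : Type*} [NormedAddCommGroup V] [NormedSpace ℝ V]

/-! ### Cones of rank `k` and the order relation -/

/-- `C` is a `k`-cone: a closed set, stable under multiplication by every real scalar, such that
`k ≥ 1` is the largest dimension of a linear subspace contained in `C`. -/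
structure IsKCone (k : ℕ) (C : Set V) : Prop where
  one_le : 1 ≤ k
  isClosed : IsClosed C
  smul_mem : ∀ v ∈ C, ∀ l : ℝ, l • v ∈ C
  isGreatest : IsGreatest
    {d : ℕ | ∃ W : Submodule ℝ V, (W : Set V) ⊆ C ∧ Module.finrank ℝ W = d} k

/-- `x ∼ y`. -/
def Ordered (C : Set V) (x y : V) : Prop := x - y ∈ C

/-- `x ≈ y`. -/
def StronglyOrdered (C : Set V) (x y : V) : Prop := x - y ∈ interior C

/-! ### The standing assumptions on the flow -/

/-- The flow is strongly monotone with respect to `C`. -/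
structure StronglyMonotone (Φ : Flow ℝ V) (C : Set V) : Prop where
  monotone : ∀ x y : V, Ordered C x y → ∀ t : ℝ, 0 ≤ t → Ordered C (Φ t x) (Φ t y)
  strongly : ∀ x y : V, x ≠ y → Ordered C x y → ∀ t : ℝ, 0 < t →
    StronglyOrdered C (Φ t x) (Φ t y)

/-- The flow is `C^{1,α}` as a map of the pair `(t, x)`: it is `C¹` and its derivative is locally
Hölder continuous with exponent `α`. -/
structure IsC1Alpha (Φ : Flow ℝ V) (α : ℝ≥0) : Prop where
  contDiff : ContDiff ℝ 1 (fun p : ℝ × V => Φ p.1 p.2)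
  holder : ∀ p : ℝ × V, ∃ U ∈ 𝓝 p, ∃ H : ℝ≥0,
    HolderOnWith H α (fderiv ℝ (fun q : ℝ × V => Φ q.1 q.2)) U

/-- The derivative `D_x Φ_t` of the time-`t` map at the point `x`. -/
def spaceDeriv (Φ : Flow ℝ V) (t : ℝ) (x : V) : V →L[ℝ] V := fderiv ℝ (Φ t) x

/-- The flow is `C^{1,α}` for some `α ∈ (0,1]`, it is strongly monotone with respect to the
`k`-cone `C`, and `D_x Φ_t` maps `C \ {0}` into the interior of `C` for `t > 0`.  (The existence
of a `k`-dimensional `W` with `W \ {0} ⊆ interior C` follows: take `W = D_x Φ_1 W₀` with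
`W₀ ⊆ C` of dimension `k`.) -/
structure FWW (Φ : Flow ℝ V) (C : Set V) (k : ℕ) : Prop where
  isKCone : IsKCone k C
  smooth : ∃ α : ℝ≥0, 0 < α ∧ α ≤ 1 ∧ IsC1Alpha Φ α
  stronglyMonotone : StronglyMonotone Φ C
  spaceDeriv_mem : ∀ (x : V) (t : ℝ), 0 < t → ∀ v ∈ C, v ≠ 0 → spaceDeriv Φ t x v ∈ interior C

/-! ### Orbits, limit sets, pseudo-ordered orbits -/

/-- The `ω`-limit set of a point: the intersection over `s` of the closures of
`{Φ_t(x) : t ≥ s}`. -/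
def omega (Φ : Flow ℝ V) (x : V) : Set V := omegaLimit atTop Φ {x}

/-- `D` is `ω`-compact: forward orbits of its points are bounded, and so is the union of the
`ω`-limit sets of its points. -/
def OmegaCompact (Φ : Flow ℝ V) (D : Set V) : Prop :=
  (∀ x ∈ D, Bornology.IsBounded (Φ.forwardOrbit x)) ∧
    Bornology.IsBounded (⋃ x ∈ D, omega Φ x)

/-- An equilibrium is a point whose forward orbit is that point alone. -/
def IsEquilibrium (Φ : Flow ℝ V) (x : V) : Prop := Φ.forwardOrbit x = {x}

/-- `Q`: the points whose orbit is pseudo-ordered, i.e. nontrivial and containing two distinct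
ordered points. -/
def pseudoOrdered (Φ : Flow ℝ V) (C : Set V) : Set V :=
  {x | ¬ IsEquilibrium Φ x ∧
    ∃ p ∈ Φ.forwardOrbit x, ∃ q ∈ Φ.forwardOrbit x, p ≠ q ∧ Ordered C p q}

/-! ### Exponential separation -/

/-- The gap metric on subspaces: the Hausdorff distance of their unit spheres. -/
def gap (L₁ L₂ : Submodule ℝ V) : ℝ :=
  Metric.hausdorffDist {v | v ∈ L₁ ∧ ‖v‖ = 1} {v | v ∈ L₂ ∧ ‖v‖ = 1}

/-- `K × (Y_x)` is a `d`-dimensional continuous bundle: the map `x ↦ Y_x` from `K` to the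
Grassmannian of `d`-dimensional subspaces is continuous for the gap metric.  Values of `Y` outside
`K` are irrelevant. -/
structure IsContinuousBundle (K : Set V) (d : ℕ) (Y : V → Submodule ℝ V) : Prop where
  finrank_eq : ∀ x ∈ K, Module.finrank ℝ (Y x) = d
  continuous : ∀ x ∈ K, Tendsto (fun y => gap (Y y) (Y x)) (𝓝[K] x) (𝓝 0)

/-- `E ⊕ F` is a `k`-exponential separation of the linearized flow along `K` associated
with `C`. -/
structure IsExponentialSeparation (Φ : Flow ℝ V) (C : Set V) (k : ℕ) (K : Set V)
    (E F : V → Submodule ℝ V) : Prop where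
  bundle_E : IsContinuousBundle K k E
  bundle_F : IsContinuousBundle K (Module.finrank ℝ V - k) F
  isCompl : ∀ x ∈ K, IsCompl (E x) (F x)
  map_E : ∀ x ∈ K, ∀ t : ℝ, 0 < t →
    (E x).map (spaceDeriv Φ t x : V →ₗ[ℝ] V) = E (Φ t x)
  map_F : ∀ x ∈ K, ∀ t : ℝ, 0 < t →
    (F x).map (spaceDeriv Φ t x : V →ₗ[ℝ] V) ≤ F (Φ t x)
  separation : ∃ M γ : ℝ, 0 < M ∧ 0 < γ ∧ γ < 1 ∧
    ∀ x ∈ K, ∀ w ∈ F x, ‖w‖ = 1 → ∀ v ∈ E x, ‖v‖ = 1 → ∀ t : ℝ, 0 ≤ t →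
      ‖spaceDeriv Φ t x w‖ ≤ M * γ ^ t * ‖spaceDeriv Φ t x v‖
  E_subset : ∀ x ∈ K, (E x : Set V) ⊆ interior C ∪ {0}
  F_inter : ∀ x ∈ K, (F x : Set V) ∩ C = {0}

/-! ### The `k`-Lyapunov exponent and regular points -/

/-- The infimum norm `m(A|_L)`: the infimum of `‖A v‖` over the unit vectors `v ∈ L`. -/
def infNorm (A : V →L[ℝ] V) (L : Submodule ℝ V) : ℝ :=
  sInf ((fun v => ‖A v‖) '' {v | v ∈ L ∧ ‖v‖ = 1})

/-- The quotient `log m(D_xΦ_t|_{E_x}) / t`, as an extended real number. -/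
def growthRate (Φ : Flow ℝ V) (E : V → Submodule ℝ V) (x : V) (t : ℝ) : EReal :=
  ((Real.log (infNorm (spaceDeriv Φ t x) (E x)) / t : ℝ) : EReal)

/-- The `k`-Lyapunov exponent `λ_{kx}`: the upper limit of the growth rate as `t → +∞`. -/
def lyapunov (Φ : Flow ℝ V) (E : V → Submodule ℝ V) (x : V) : EReal :=
  limsup (growthRate Φ E x) atTop

/-- `x` is regular: the `k`-Lyapunov exponent is a limit. -/
def IsRegular (Φ : Flow ℝ V) (E : V → Submodule ℝ V) (x : V) : Prop :=
  Tendsto (growthRate Φ E x) atTop (𝓝 (lyapunov Φ E x))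

/-- `ω₀(x)`: the regular points of the `ω`-limit set. -/
def regularOmega (Φ : Flow ℝ V) (E : V → Submodule ℝ V) (x : V) : Set V :=
  {z | z ∈ omega Φ x ∧ IsRegular Φ E z}

end ConeFlow

end

open ConeFlow

open ConeFlow

namespace ConeFlow

section

variable {V : Type*} [NormedAddCommGroup V] [NormedSpace ℝ V]

/-! ### Frames and compactness of the Grassmannian -/

/-! Write `K` for `ω(x)`, which is compact and invariant, and `S_t` for the linearized flow.

Existence of the separation. By compactness, `S_1` maps the cone over `K` into itself with a uniform
margin. Pushing `k`-dimensional subspaces of `C` forward from the distant past and taking limits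
yields a `k`-dimensional space `E_z` of vectors whose whole backward orbit lies in `C`
(`exists_submodule_subset_coneCore`). Since `C` contains no subspace of dimension `k + 1`, a map
preserving `C` cannot stretch a vector transversally to such a space much more than it stretches the
space itself (`IsKCone.exists_domination`). The margin permits replacing `S_1` by a map that is
larger by a factor `1 + δ` transversally to `E`; applied to the enlarged maps, the same bound makes
`E` dominate at the exponential rate `(1 + δ)⁻¹` (`exists_exponential_domination`). Correcting a
vector along `E` by a convergent series turns this estimate modulo `E` into a genuine complement
`F_z` (`exists_splitsUniformly`). Maximality of `k` again shows that `F_z` meets `C` only in `0` and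
that `E_z` is unique, and continuity follows from closed graphs.

Pseudo-ordered points near `x`. The logarithm of the infimum norm of `S_t` on `E` is a superadditive
cocycle; let `β` be the limit of `b_n / n`, where `b_n` is its infimum over `K` at time `n`. If `β ≤
0`, a shift argument (`exists_slow_shift`) and compactness give a point of `K` at which the cocycle
is at most `β n` for every `n`; as it is also at least `b_n`, that point is regular with exponent `β
≤ 0`, which is excluded. Hence `β > 0`, so `E` expands uniformly over `K`, and by domination so does
the whole cone (`exists_expands_cone`). The nonlinear flow then drives a point ordered with `x` away
from the orbit of `x`, however close it starts. But if `x` were outside the closure of `Q`, its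
orbit would be stable under ordered perturbations (`stable_of_notMem_closure_pseudoOrdered`), a
contradiction. -/

/-- The `d`-frames of `V` that are orthonormal for the Euclidean structure given by
`toEuclidean`. -/
def frames (V : Type*) [NormedAddCommGroup V] [NormedSpace ℝ V] [FiniteDimensional ℝ V] (d : ℕ) :
    Set (Fin d → V) :=
  {e | Orthonormal ℝ (fun i => toEuclidean (e i))}

theorem finrank_map_of_injective (L : V →L[ℝ] V) (E : Submodule ℝ V)
    (hinj : ∀ v ∈ E, L v = 0 → v = 0) :
    Module.finrank ℝ (E.map (L : V →ₗ[ℝ] V)) = Module.finrank ℝ E := by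
  rw [← LinearMap.range_domRestrict]
  refine LinearMap.finrank_range_of_inj ?_
  rw [← LinearMap.ker_eq_bot, LinearMap.ker_eq_bot']
  intro v hv
  exact Subtype.ext (hinj v v.2 hv)

section Frames

variable [FiniteDimensional ℝ V]

/-- This serves as compactness of the Grassmannian: limits of orthonormal frames are still
independent, so limits of subspaces keep their dimension. -/
theorem isCompact_frames (d : ℕ) : IsCompact (frames V d) := by
  refine Metric.isCompact_of_isClosed_isBounded ?_ ?_
  · have : frames V d = ⋂ i, ⋂ j, {e : Fin d → V |
        inner ℝ (toEuclidean (e i)) (toEuclidean (e j)) = if i = j then (1 : ℝ) else 0} := by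
      ext e
      simp only [frames, Set.mem_ofPred_eq, Set.mem_iInter, orthonormal_iff_ite]
    rw [this]
    refine isClosed_iInter fun i => isClosed_iInter fun j => isClosed_eq ?_ continuous_const
    exact ((toEuclidean (E := V)).continuous.comp (continuous_apply i)).inner
      ((toEuclidean (E := V)).continuous.comp (continuous_apply j))
  · refine (Metric.isBounded_closedBall (x := (0 : Fin d → V))
      (r := ‖(toEuclidean (E := V)).symm.toContinuousLinearMap‖)).subset fun e he => ?_
    rw [mem_closedBall_zero_iff, pi_norm_le_iff_of_nonneg (norm_nonneg _)]
    intro i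
    have h := (toEuclidean (E := V)).symm.toContinuousLinearMap.le_opNorm (toEuclidean (e i))
    rw [he.1 i, mul_one] at h
    simpa using h

theorem linearIndependent_of_mem_frames {d : ℕ} {e : Fin d → V} (he : e ∈ frames V d) :
    LinearIndependent ℝ e := by
  have h : LinearIndependent ℝ (fun i => (toEuclidean (E := V)) (e i)) := he.linearIndependent
  exact LinearIndependent.of_comp (toEuclidean (E := V)).toLinearEquiv.toLinearMap h

theorem finrank_span_of_mem_frames {d : ℕ} {e : Fin d → V} (he : e ∈ frames V d) :
    Module.finrank ℝ (Submodule.span ℝ (Set.range e)) = d := by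
  simpa using finrank_span_eq_card (linearIndependent_of_mem_frames he)

theorem exists_frame {d : ℕ} (P : Submodule ℝ V) (hP : Module.finrank ℝ P = d) :
    ∃ e ∈ frames V d, Submodule.span ℝ (Set.range e) = P := by
  set T := (toEuclidean (E := V))
  set P' := P.map T.toLinearEquiv.toLinearMap with hP'
  have hd : Module.finrank ℝ P' = d := by
    rw [hP', LinearEquiv.finrank_map_eq, hP]
  let b := (stdOrthonormalBasis ℝ P').reindex (finCongr hd)
  have hb : Orthonormal ℝ (fun i => ((b i : P') : EuclideanSpace ℝ (Fin (Module.finrank ℝ V)))) :=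
    b.orthonormal.comp_linearIsometry P'.subtypeₗᵢ
  have he : (fun i => T.symm (b i : EuclideanSpace ℝ (Fin (Module.finrank ℝ V)))) ∈ frames V d := by
    simpa [frames, T] using hb
  refine ⟨_, he, ?_⟩
  refine Submodule.eq_of_le_of_finrank_eq ?_ ?_
  · rw [Submodule.span_le]
    rintro _ ⟨i, rfl⟩
    obtain ⟨p, hp, hpb⟩ := Submodule.mem_map.1 (b i).2
    have : T.symm (b i : EuclideanSpace ℝ (Fin (Module.finrank ℝ V))) = p := by
      rw [← hpb]
      exact T.symm_apply_apply p
    simpa [this] using hp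
  · rw [finrank_span_of_mem_frames he, hP]

/-- A sequence of `d`-dimensional subspaces has a convergent subsequence. -/
theorem exists_frame_tendsto {d : ℕ} (P : ℕ → Submodule ℝ V)
    (hP : ∀ j, Module.finrank ℝ (P j) = d) :
    ∃ e ∈ frames V d, ∃ φ : ℕ → ℕ, StrictMono φ ∧ ∃ f : ℕ → Fin d → V,
      (∀ j, Submodule.span ℝ (Set.range (f j)) = P (φ j)) ∧ Tendsto f atTop (𝓝 e) := by
  choose f hf hfP using fun j => exists_frame (P j) (hP j)
  obtain ⟨e, he, φ, hφ, hlim⟩ := (isCompact_frames (V := V) d).tendsto_subseq hf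
  exact ⟨e, he, φ, hφ, fun j => f (φ j), fun j => hfP _, hlim⟩

/-- Subspaces of dimension larger than the rank of the cone contain vectors that are uniformly far
from the cone. -/
theorem IsKCone.exists_far_vector {C : Set V} {k : ℕ} (hC : IsKCone k C) :
    ∃ ε₀ > 0, ∀ P : Submodule ℝ V, Module.finrank ℝ P = k + 1 →
      ∃ p ∈ P, p ≠ 0 ∧ ∀ c ∈ C, ε₀ * ‖p‖ < ‖p - c‖ := by
  by_contra! hcon
  choose P hP hPC using fun j : ℕ => hcon (1 / ((j : ℝ) + 1)) (by positivity)
  obtain ⟨e, he, φ, hφ, f, hf, hlim⟩ := exists_frame_tendsto P hP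
  -- A limit of `(k + 1)`-dimensional subspaces that come ever closer to `C` is a `(k +
  -- 1)`-dimensional subspace of `C`, against the maximality of `k`.
  have hsub : (Submodule.span ℝ (Set.range e) : Set V) ⊆ C := by
    intro p hp
    obtain ⟨c, rfl⟩ := (Submodule.mem_span_range_iff_exists_fun ℝ).1 hp
    by_cases hp0 : ∑ i, c i • e i = 0
    · obtain ⟨v, hv⟩ : C.Nonempty := by
        obtain ⟨W, hW, -⟩ := hC.isGreatest.1
        exact ⟨0, hW W.zero_mem⟩
      rw [hp0]
      simpa using hC.smul_mem v hv 0
    set p : ℕ → V := fun j => ∑ i, c i • f j i with hpdef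
    have hpl : Tendsto p atTop (𝓝 (∑ i, c i • e i)) := by
      refine tendsto_finsetSum _ fun i _ => ?_
      exact ((tendsto_pi_nhds.1 hlim) i).const_smul (c i)
    have hpP : ∀ j, p j ∈ P (φ j) := fun j => by
      rw [← hf j]
      exact (Submodule.mem_span_range_iff_exists_fun ℝ).2 ⟨c, rfl⟩
    have hne : ∀ᶠ j in atTop, p j ≠ 0 := hpl.eventually_ne hp0
    have hex : ∀ j, ∃ q, p j ≠ 0 → q ∈ C ∧ ‖p j - q‖ ≤ 1 / ((φ j : ℝ) + 1) * ‖p j‖ := fun j => by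
      by_cases h : p j = 0
      · exact ⟨0, fun h' => absurd h h'⟩
      · obtain ⟨q, hq, hq'⟩ := hPC (φ j) (p j) (hpP j) h
        exact ⟨q, fun _ => ⟨hq, hq'⟩⟩
    choose q hq using hex
    have hdiff : Tendsto (fun j => p j - q j) atTop (𝓝 0) := by
      have h1 : Tendsto (fun j => 1 / ((φ j : ℝ) + 1) * ‖p j‖) atTop (𝓝 0) := by
        have := (tendsto_one_div_add_atTop_nhds_zero_nat (𝕜 := ℝ)).comp hφ.tendsto_atTop
        simpa using this.mul hpl.norm
      refine squeeze_zero_norm' ?_ h1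
      filter_upwards [hne] with j hj using (hq j hj).2
    have hql : Tendsto q atTop (𝓝 (∑ i, c i • e i)) := by
      simpa using hpl.sub hdiff
    refine hC.isClosed.mem_of_tendsto hql ?_
    filter_upwards [hne] with j hj using (hq j hj).1
  have := hC.isGreatest.2 ⟨_, hsub, finrank_span_of_mem_frames he⟩
  omega

/-- Every subspace is the range of a projection whose norm is bounded by a constant depending only
on the ambient space. -/
theorem exists_bounded_projection (V : Type*) [NormedAddCommGroup V] [NormedSpace ℝ V]
    [FiniteDimensional ℝ V] :
    ∃ c : ℝ, 1 ≤ c ∧ ∀ E : Submodule ℝ V, ∃ π : V →L[ℝ] V, (∀ v, π v ∈ E) ∧ (∀ v ∈ E, π v = v) ∧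
      (∀ v, ‖π v‖ ≤ c * ‖v‖) ∧ ∀ v, ‖v - π v‖ ≤ c * ‖v‖ := by
  set T := (toEuclidean (E := V)) with hT
  set a := ‖T.symm.toContinuousLinearMap‖ * ‖T.toContinuousLinearMap‖ with ha
  have ha0 : 0 ≤ a := by positivity
  refine ⟨1 + a, by linarith, fun E => ?_⟩
  set E' := E.map T.toLinearEquiv.toLinearMap with hE'
  let π : V →L[ℝ] V := T.symm.toContinuousLinearMap ∘L E'.starProjection ∘L T.toContinuousLinearMap
  have hπ : ∀ v, π v = T.symm (E'.starProjection (T v)) := fun v => rfl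
  have hb : ∀ v, ‖π v‖ ≤ a * ‖v‖ := fun v => by
    rw [hπ, ha, mul_assoc]
    refine (T.symm.toContinuousLinearMap.le_opNorm _).trans ?_
    gcongr
    refine (E'.starProjection.le_opNorm _).trans ?_
    refine (mul_le_mul_of_nonneg_right E'.starProjection_norm_le (norm_nonneg _)).trans ?_
    rw [one_mul]
    exact T.toContinuousLinearMap.le_opNorm _
  refine ⟨π, fun v => ?_, fun v hv => ?_, fun v => ?_, fun v => ?_⟩
  · obtain ⟨p, hp, hpb⟩ := Submodule.mem_map.1 (E'.starProjection_apply_mem (T v))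
    rw [hπ, ← hpb]
    have : T.symm (T p) = p := T.symm_apply_apply p
    change T.symm (T p) ∈ E
    rwa [this]
  · have hTv : T v ∈ E' := Submodule.mem_map.2 ⟨v, hv, rfl⟩
    rw [hπ, Submodule.starProjection_eq_self_iff.2 hTv]
    exact T.symm_apply_apply v
  · nlinarith [hb v, norm_nonneg v]
  · linarith [norm_sub_le v (π v), hb v]

/-- A linear map that preserves the cone dominates on a thick `k`-dimensional subspace of the
cone, with a constant that does not depend on the map. -/
theorem IsKCone.exists_domination {C : Set V} {k : ℕ} (hC : IsKCone k C) {ε : ℝ} (hε : 0 < ε) :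
    ∃ R : ℝ, 0 < R ∧ ∀ (L : V →L[ℝ] V) (E : Submodule ℝ V), Module.finrank ℝ E = k →
      (∀ v ∈ C, L v ∈ C) → (∀ v ∈ E, L v = 0 → v = 0) →
      (∀ u ∈ E, ∀ w, ‖w‖ ≤ ε * ‖u‖ → u + w ∈ C) →
      ∀ v ∈ E, ∀ w, ∃ e ∈ E, ‖v‖ * ‖L w - L e‖ ≤ R * ‖L v‖ * ‖w‖ := by
  obtain ⟨ε₀, hε₀, hfar⟩ := hC.exists_far_vector
  refine ⟨2 / (ε * ε₀), by positivity, fun L E hE hLC hinj hthick v hv w => ?_⟩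
  by_contra! hcon
  have hv0 : 0 < ‖v‖ := by
    rcases (norm_nonneg v).eq_or_lt with h | h
    · have := hcon 0 E.zero_mem
      rw [← h, zero_mul] at this
      exact absurd this (not_lt.2 (by positivity))
    · exact h
  -- If the bound fails, `L E` and `L w` span a space of dimension `k + 1`, which contains some `p =
  -- L u + t L w` far from `C`. The contradiction comes from a point of `C` too close to `p`.
  have hnot : L w ∉ E.map (L : V →ₗ[ℝ] V) := by
    rintro ⟨e, he, hew⟩
    have := hcon e he
    have hew' : L e = L w := hew
    rw [hew', sub_self, norm_zero, mul_zero] at this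
    exact absurd this (not_lt.2 (by positivity))
  have hrank : Module.finrank ℝ (E.map (L : V →ₗ[ℝ] V)) = k := by
    rw [finrank_map_of_injective L E hinj, hE]
  have hP := Submodule.finrank_sup_span_singleton (K := ℝ) hnot
  rw [hrank] at hP
  obtain ⟨p, hp, hp0, hpC⟩ := hfar _ hP
  obtain ⟨_, ⟨u, hu, rfl⟩, q, hq, rfl⟩ := Submodule.mem_sup.1 hp
  obtain ⟨t, rfl⟩ := Submodule.mem_span_singleton.1 hq
  -- The size of `s` gives `ε ‖s v‖ = 2 |t| ‖w‖`: when `u` is too short for `u + t w` to lie in `C`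
  -- by thickness, `u + s v` is long enough. The image of the corrected vector is in `C` at distance
  -- at most `s ‖L v‖` from `p`; the constant `2 / (ε ε₀)` is what makes this too close.
  set s := 2 * |t| * ‖w‖ / (ε * ‖v‖) with hs
  have hs0 : 0 ≤ s := by positivity
  have hkey : ∃ s' : ℝ, |s'| ≤ s ∧ |t| * ‖w‖ ≤ ε * ‖u + s' • v‖ := by
    by_cases h : |t| * ‖w‖ ≤ ε * ‖u‖
    · exact ⟨0, by simpa using hs0, by simpa using h⟩
    · refine ⟨s, (abs_of_nonneg hs0).le, ?_⟩
      push Not at h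
      have h1 : ‖s • v‖ = s * ‖v‖ := by rw [norm_smul, Real.norm_of_nonneg hs0]
      have h2 : ε * (s * ‖v‖) = 2 * (|t| * ‖w‖) := by rw [hs]; field_simp
      have h3 : ‖s • v‖ ≤ ‖u + s • v‖ + ‖u‖ := by
        simpa using norm_sub_le (u + s • v) u
      nlinarith
  obtain ⟨s', hs', hkey⟩ := hkey
  have hmem : L ((u + s' • v) + t • w) ∈ C := by
    refine hLC _ (hthick _ (E.add_mem hu (E.smul_mem _ hv)) _ ?_)
    rwa [norm_smul, Real.norm_eq_abs]
  have hfin := hpC _ hmem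
  have e1 : (L : V →ₗ[ℝ] V) u + t • L w - L ((u + s' • v) + t • w) = -(s' • L v) := by
    simp only [ContinuousLinearMap.coe_coe, map_add, map_smul]
    abel
  rw [e1, norm_neg, norm_smul, Real.norm_eq_abs] at hfin
  have hp_norm : 2 / (ε * ε₀) * ‖L v‖ * ‖w‖ * |t| ≤ ‖v‖ * ‖(L : V →ₗ[ℝ] V) u + t • L w‖ := by
    by_cases ht : t = 0
    · simp only [ht, abs_zero, mul_zero]
      positivity
    have h1 := hcon (-(t⁻¹ • u)) (E.neg_mem (E.smul_mem _ hu))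
    have h2 : (L : V →ₗ[ℝ] V) u + t • L w = t • (L w - L (-(t⁻¹ • u))) := by
      simp only [ContinuousLinearMap.coe_coe, map_neg, map_smul, sub_neg_eq_add, smul_add, smul_smul,
        mul_inv_cancel₀ ht, one_smul]
      abel
    rw [h2, norm_smul, Real.norm_eq_abs]
    nlinarith [abs_nonneg t]
  have h4 : |s'| * ‖L v‖ ≤ s * ‖L v‖ := by gcongr
  have h5 : s * ‖L v‖ * ‖v‖ ≤ ε₀ * (‖v‖ * ‖(L : V →ₗ[ℝ] V) u + t • L w‖) := by
    have : s * ‖L v‖ * ‖v‖ = ε₀ * (2 / (ε * ε₀) * ‖L v‖ * ‖w‖ * |t|) := by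
      rw [hs]; field_simp
    rw [this]
    gcongr
  nlinarith

end Frames

/-! ### Continuity of bundles and closed graphs -/

/-- The graph of `Y` over `K` is sequentially closed. -/
def HasClosedGraph (K : Set V) (Y : V → Submodule ℝ V) : Prop :=
  ∀ (z : ℕ → V) (z₀ : V), (∀ j, z j ∈ K) → z₀ ∈ K → Tendsto z atTop (𝓝 z₀) →
    ∀ (v : ℕ → V) (v₀ : V), (∀ j, v j ∈ Y (z j)) → Tendsto v atTop (𝓝 v₀) → v₀ ∈ Y z₀

/-- The gap has two halves. That unit vectors of `Y y` are close to `Y x` is the closed graph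
together with compactness of the sphere. For the converse, constancy of the dimension is essential:
a limit of the spaces `Y y` lies in `Y x` and has the same dimension, hence is all of it. -/
theorem HasClosedGraph.isContinuousBundle [FiniteDimensional ℝ V] {K : Set V} {d : ℕ}
    {Y : V → Submodule ℝ V} (hY : HasClosedGraph K Y)
    (hd : ∀ z ∈ K, Module.finrank ℝ (Y z) = d) : IsContinuousBundle K d Y := by
  refine ⟨hd, fun x hx => ?_⟩
  have upper : ∀ ε > 0, ∀ᶠ y in 𝓝[K] x, ∀ v ∈ Y y, ‖v‖ = 1 →
      ∃ w ∈ {w | w ∈ Y x ∧ ‖w‖ = 1}, dist v w ≤ ε := by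
    intro ε hε
    by_contra hcon
    obtain ⟨z, hz, hbad⟩ := exists_seq_forall_of_frequently
      ((not_eventually.1 hcon).and_eventually self_mem_nhdsWithin)
    have hzK : ∀ j, z j ∈ K := fun j => (hbad j).2
    have hb := fun j => (hbad j).1
    push Not at hb
    choose v hv hv1 hvbad using hb
    obtain ⟨w, hw, φ, hφ, hlim⟩ := (isCompact_sphere (0 : V) 1).tendsto_subseq
      (x := v) (fun j => by simpa using hv1 j)
    have hwY : w ∈ Y x := hY (fun j => z (φ j)) x (fun j => hzK _) hx
      ((tendsto_nhds_of_tendsto_nhdsWithin hz).comp hφ.tendsto_atTop) _ w (fun j => hv _) hlim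
    have hw1 : ‖w‖ = 1 := by simpa using hw
    obtain ⟨j, hj⟩ := (hlim.eventually (Metric.ball_mem_nhds w hε)).exists
    exact (lt_asymm (hvbad (φ j) w ⟨hwY, hw1⟩) hj)
  have lower : ∀ ε > 0, ∀ᶠ y in 𝓝[K] x, ∀ w ∈ Y x, ‖w‖ = 1 →
      ∃ v ∈ {v | v ∈ Y y ∧ ‖v‖ = 1}, dist w v ≤ ε := by
    intro ε hε
    by_contra hcon
    obtain ⟨z, hz, hbad⟩ := exists_seq_forall_of_frequently
      ((not_eventually.1 hcon).and_eventually self_mem_nhdsWithin)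
    have hzK : ∀ j, z j ∈ K := fun j => (hbad j).2
    have hb := fun j => (hbad j).1
    push Not at hb
    choose w hw hw1 hwbad using hb
    obtain ⟨w₀, hw₀, φ, hφ, hlim⟩ := (isCompact_sphere (0 : V) 1).tendsto_subseq
      (x := w) (fun j => by simpa using hw1 j)
    have hw₀1 : ‖w₀‖ = 1 := by simpa using hw₀
    have hw₀x : w₀ ∈ Y x := (Submodule.closed_of_finiteDimensional (Y x)).mem_of_tendsto hlim
      (Eventually.of_forall fun j => hw _)
    obtain ⟨e, he, ψ, hψ, f, hf, hfe⟩ := exists_frame_tendsto (fun j => Y (z (φ j)))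
      (fun j => hd _ (hzK _))
    have hzlim : Tendsto (fun j => z (φ (ψ j))) atTop (𝓝 x) :=
      (tendsto_nhds_of_tendsto_nhdsWithin hz).comp (hφ.tendsto_atTop.comp hψ.tendsto_atTop)
    have hspan : Submodule.span ℝ (Set.range e) = Y x := by
      refine Submodule.eq_of_le_of_finrank_eq ?_ (by rw [finrank_span_of_mem_frames he, hd x hx])
      rw [Submodule.span_le]
      rintro _ ⟨i, rfl⟩
      refine hY _ x (fun j => hzK _) hx hzlim (fun j => f j i) _ (fun j => ?_)
        (tendsto_pi_nhds.1 hfe i)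
      have := hf j
      rw [← this]
      exact Submodule.subset_span ⟨i, rfl⟩
    rw [← hspan] at hw₀x
    obtain ⟨c, hc⟩ := (Submodule.mem_span_range_iff_exists_fun ℝ).1 hw₀x
    set p : ℕ → V := fun j => ∑ i, c i • f j i with hpdef
    have hpl : Tendsto p atTop (𝓝 w₀) := by
      rw [← hc]
      exact tendsto_finsetSum _ fun i _ => ((tendsto_pi_nhds.1 hfe) i).const_smul (c i)
    have hpY : ∀ j, p j ∈ Y (z (φ (ψ j))) := fun j => by
      have := hf j
      rw [← this]
      exact (Submodule.mem_span_range_iff_exists_fun ℝ).2 ⟨c, rfl⟩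
    have hql : Tendsto (fun j => ‖p j‖⁻¹ • p j) atTop (𝓝 w₀) := by
      have h1 := (hpl.norm.inv₀ (by rw [hw₀1]; exact one_ne_zero)).smul hpl
      simpa [hw₀1] using h1
    have hdist : Tendsto (fun j => dist (w (φ (ψ j))) (‖p j‖⁻¹ • p j)) atTop (𝓝 0) := by
      simpa using (hlim.comp hψ.tendsto_atTop).dist hql
    have hne : ∀ᶠ j in atTop, p j ≠ 0 := hpl.eventually_ne (by
      intro h
      rw [h, norm_zero] at hw₀1
      exact zero_ne_one hw₀1)
    obtain ⟨j, hj, hj0⟩ := ((hdist.eventually (gt_mem_nhds hε)).and hne).exists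
    refine lt_asymm (hwbad (φ (ψ j)) (‖p j‖⁻¹ • p j) ⟨Submodule.smul_mem _ _ (hpY j), ?_⟩) hj
    rw [norm_smul, norm_inv, norm_norm, inv_mul_cancel₀ (norm_ne_zero_iff.2 hj0)]
  rw [Metric.tendsto_nhds]
  intro ε hε
  filter_upwards [upper (ε / 2) (half_pos hε), lower (ε / 2) (half_pos hε)] with y hy₁ hy₂
  rw [Real.dist_0_eq_abs, gap, abs_of_nonneg Metric.hausdorffDist_nonneg]
  exact (Metric.hausdorffDist_le_of_mem_dist (half_pos hε).le (fun v hv => hy₁ v hv.1 hv.2)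
    (fun w hw => hy₂ w hw.1 hw.2)).trans_lt (half_lt_self hε)

theorem IsContinuousBundle.hasClosedGraph [FiniteDimensional ℝ V] {K : Set V} {d : ℕ}
    {Y : V → Submodule ℝ V} (hY : IsContinuousBundle K d Y) : HasClosedGraph K Y := by
  intro z z₀ hz hz₀ hlim v v₀ hv hvlim
  by_cases hv0 : v₀ = 0
  · rw [hv0]
    exact (Y z₀).zero_mem
  have hpos : 0 < ‖v₀‖ := norm_pos_iff.2 hv0
  have hne : ∀ᶠ j in atTop, v j ≠ 0 := hvlim.eventually_ne hv0
  -- A positive dimension makes the unit spheres nonempty; against an empty set the real-valued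
  -- Hausdorff distance takes its default value `0` and would control nothing.
  have hd : 0 < d := by
    obtain ⟨j, hj⟩ := hne.exists
    rw [← hY.finrank_eq _ (hz j)]
    exact Module.finrank_pos_iff_exists_ne_zero.2 ⟨⟨v j, hv j⟩, fun h => hj (congrArg Subtype.val h)⟩
  have hsphere : ({v | v ∈ Y z₀ ∧ ‖v‖ = 1} : Set V).Nonempty := by
    rw [← hY.finrank_eq _ hz₀] at hd
    obtain ⟨⟨u, hu⟩, hu0⟩ := Module.finrank_pos_iff_exists_ne_zero.1 hd
    have hu0' : u ≠ 0 := fun h => hu0 (Subtype.ext h)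
    refine ⟨‖u‖⁻¹ • u, (Y z₀).smul_mem _ hu, ?_⟩
    rw [norm_smul, norm_inv, norm_norm, inv_mul_cancel₀ (norm_ne_zero_iff.2 hu0')]
  have hclosed : IsClosed ({v | v ∈ Y z₀ ∧ ‖v‖ = 1} : Set V) :=
    (Submodule.closed_of_finiteDimensional (Y z₀)).inter (isClosed_eq continuous_norm continuous_const)
  have hbdd : ∀ W : Submodule ℝ V, Bornology.IsBounded ({v | v ∈ W ∧ ‖v‖ = 1} : Set V) := fun W =>
    (Metric.isBounded_sphere (x := (0 : V)) (r := 1)).subset fun v hv => by simpa using hv.2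
  have hgap : Tendsto (fun j => gap (Y (z j)) (Y z₀)) atTop (𝓝 0) :=
    (hY.continuous z₀ hz₀).comp
      (tendsto_nhdsWithin_iff.2 ⟨hlim, Eventually.of_forall hz⟩)
  have hu : Tendsto (fun j => ‖v j‖⁻¹ • v j) atTop (𝓝 (‖v₀‖⁻¹ • v₀)) :=
    (hvlim.norm.inv₀ hpos.ne').smul hvlim
  have hinf : Tendsto (fun j => Metric.infDist (‖v j‖⁻¹ • v j) {v | v ∈ Y z₀ ∧ ‖v‖ = 1}) atTop
      (𝓝 0) := by
    refine squeeze_zero' (Eventually.of_forall fun j => Metric.infDist_nonneg) ?_ hgap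
    filter_upwards [hne] with j hj
    have hmem : ‖v j‖⁻¹ • v j ∈ ({v | v ∈ Y (z j) ∧ ‖v‖ = 1} : Set V) :=
      ⟨(Y (z j)).smul_mem _ (hv j), by
        rw [norm_smul, norm_inv, norm_norm, inv_mul_cancel₀ (norm_ne_zero_iff.2 hj)]⟩
    exact Metric.infDist_le_hausdorffDist_of_mem hmem
      (Metric.hausdorffEDist_ne_top_of_nonempty_of_bounded ⟨_, hmem⟩ hsphere (hbdd _) (hbdd _))
  have hzero : Metric.infDist (‖v₀‖⁻¹ • v₀) {v | v ∈ Y z₀ ∧ ‖v‖ = 1} = 0 :=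
    tendsto_nhds_unique (((Metric.continuous_infDist_pt _).tendsto _).comp hu) hinf
  have hmem := (hclosed.mem_iff_infDist_zero hsphere).2 hzero
  exact ((Y z₀).smul_mem_iff (inv_ne_zero hpos.ne')).1 hmem.1

end

section

/-! ### The linearized flow -/

section

variable {V : Type*} [NormedAddCommGroup V]

theorem flow_neg_apply (Φ : Flow ℝ V) (t : ℝ) (z : V) : Φ (-t) (Φ t z) = z := by
  rw [← Φ.map_add, neg_add_cancel, Φ.map_zero_apply]

theorem flow_apply_neg (Φ : Flow ℝ V) (t : ℝ) (z : V) : Φ t (Φ (-t) z) = z := by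
  rw [← Φ.map_add, add_neg_cancel, Φ.map_zero_apply]

theorem flow_injective (Φ : Flow ℝ V) (t : ℝ) : Function.Injective (Φ t) :=
  Function.LeftInverse.injective (flow_neg_apply Φ t)

end

variable {V : Type*} [NormedAddCommGroup V] [NormedSpace ℝ V]

section SmoothFlow

variable {Φ : Flow ℝ V} (h : ContDiff ℝ 1 (fun p : ℝ × V => Φ p.1 p.2))
include h

theorem contDiff_flow (t : ℝ) : ContDiff ℝ 1 (Φ t) :=
  h.comp (contDiff_const.prodMk contDiff_id)

theorem hasStrictFDerivAt_flow (t : ℝ) (z : V) : HasStrictFDerivAt (Φ t) (spaceDeriv Φ t z) z :=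
  ((contDiff_flow h t).contDiffAt (x := z)).hasStrictFDerivAt one_ne_zero

theorem hasFDerivAt_flow (t : ℝ) (z : V) : HasFDerivAt (Φ t) (spaceDeriv Φ t z) z :=
  (hasStrictFDerivAt_flow h t z).hasFDerivAt

theorem continuous_spaceDeriv : Continuous fun p : ℝ × V => spaceDeriv Φ p.1 p.2 := by
  have heq : (fun p : ℝ × V => spaceDeriv Φ p.1 p.2) = fun p : ℝ × V =>
      (fderiv ℝ (fun q : ℝ × V => Φ q.1 q.2) p).comp (ContinuousLinearMap.inr ℝ ℝ V) := by
    ext1 p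
    have h1 : HasFDerivAt (fun q : ℝ × V => Φ q.1 q.2)
        (fderiv ℝ (fun q : ℝ × V => Φ q.1 q.2) p) (p.1, p.2) :=
      (h.differentiable one_ne_zero p).hasFDerivAt
    exact (h1.comp p.2 (hasFDerivAt_prodMk_right p.1 p.2)).fderiv
  rw [heq]
  exact (h.continuous_fderiv one_ne_zero).clm_comp continuous_const

theorem spaceDeriv_add_apply (s t : ℝ) (z v : V) :
    spaceDeriv Φ (s + t) z v = spaceDeriv Φ s (Φ t z) (spaceDeriv Φ t z v) := by
  have h1 := (hasFDerivAt_flow h s (Φ t z)).comp z (hasFDerivAt_flow h t z)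
  have h2 : (Φ s ∘ Φ t : V → V) = Φ (s + t) := by
    funext y
    exact (Φ.map_add s t y).symm
  rw [h2] at h1
  rw [spaceDeriv, h1.fderiv]
  rfl

theorem spaceDeriv_neg_apply (t : ℝ) (z v : V) :
    spaceDeriv Φ (-t) (Φ t z) (spaceDeriv Φ t z v) = v := by
  rw [← spaceDeriv_add_apply h, neg_add_cancel, spaceDeriv, Φ.map_zero]
  simp

theorem spaceDeriv_apply_neg (t : ℝ) (z v : V) :
    spaceDeriv Φ t (Φ (-t) z) (spaceDeriv Φ (-t) z v) = v := by
  simpa using spaceDeriv_neg_apply h (-t) z v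

theorem eq_zero_of_spaceDeriv_eq_zero {t : ℝ} {z v : V} (hv : spaceDeriv Φ t z v = 0) :
    v = 0 := by
  rw [← spaceDeriv_neg_apply h t z v, hv, map_zero]

end SmoothFlow

theorem spaceDeriv_zero_apply (Φ : Flow ℝ V) (z v : V) : spaceDeriv Φ 0 z v = v := by
  simp [spaceDeriv, Φ.map_zero]

/-- The linearized flow over the compact invariant set `K` maps the cone `C` into itself, with
uniform bounds on unit time steps. -/
structure UniformlyPositive (Φ : Flow ℝ V) (C : Set V) (k : ℕ) (K : Set V) (ε M : ℝ) : Prop where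
  isKCone : IsKCone k C
  contDiff : ContDiff ℝ 1 (fun p : ℝ × V => Φ p.1 p.2)
  isCompact : IsCompact K
  invariant : ∀ z ∈ K, ∀ t, Φ t z ∈ K
  mem_cone : ∀ z t, 0 ≤ t → ∀ v ∈ C, spaceDeriv Φ t z v ∈ C
  eps_pos : 0 < ε
  one_le : 1 ≤ M
  add_mem_cone : ∀ z ∈ K, ∀ v ∈ C, ∀ w, ‖w‖ ≤ ε * ‖v‖ → spaceDeriv Φ 1 z v + w ∈ C
  norm_le : ∀ z ∈ K, ∀ t, |t| ≤ 1 → ∀ v, ‖spaceDeriv Φ t z v‖ ≤ M * ‖v‖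

theorem IsKCone.zero_mem {C : Set V} {k : ℕ} (hC : IsKCone k C) : (0 : V) ∈ C := by
  obtain ⟨W, hW, -⟩ := hC.isGreatest.1
  exact hW W.zero_mem

theorem exists_norm_spaceDeriv_le {Φ : Flow ℝ V}
    (h : ContDiff ℝ 1 (fun p : ℝ × V => Φ p.1 p.2)) {K : Set V} (hK : IsCompact K) (T : ℝ) :
    ∃ M : ℝ, 1 ≤ M ∧ ∀ z ∈ K, ∀ t, |t| ≤ T → ∀ v, ‖spaceDeriv Φ t z v‖ ≤ M * ‖v‖ := by
  obtain ⟨M, hM⟩ := (isCompact_Icc (a := -T) (b := T)).prod hK |>.exists_bound_of_continuousOn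
    (continuous_spaceDeriv h).continuousOn
  refine ⟨max M 1, le_max_right _ _, fun z hz t ht v => ?_⟩
  exact (spaceDeriv Φ t z).le_of_opNorm_le ((hM (t, z) ⟨abs_le.1 ht, hz⟩).trans (le_max_left _ _)) v

theorem FWW.mem_cone {Φ : Flow ℝ V} {C : Set V} {k : ℕ} (hΦ : FWW Φ C k) (z : V) (t : ℝ)
    (ht : 0 ≤ t) (v : V) (hv : v ∈ C) : spaceDeriv Φ t z v ∈ C := by
  rcases ht.eq_or_lt with rfl | ht
  · rwa [spaceDeriv_zero_apply]
  · by_cases hv0 : v = 0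
    · rw [hv0, map_zero]
      exact hΦ.isKCone.zero_mem
    · exact interior_subset (hΦ.spaceDeriv_mem z t ht v hv hv0)

theorem FWW.contDiff {Φ : Flow ℝ V} {C : Set V} {k : ℕ} (hΦ : FWW Φ C k) :
    ContDiff ℝ 1 (fun p : ℝ × V => Φ p.1 p.2) := by
  obtain ⟨α, -, -, h⟩ := hΦ.smooth
  exact h.contDiff

/-- The image of the unit vectors of `C` over `K` under the time-one derivative is a compact subset
of the interior of `C`, so some closed thickening of it stays inside; homogeneity extends the margin
to all vectors of `C`. -/
theorem FWW.uniformlyPositive [FiniteDimensional ℝ V] {Φ : Flow ℝ V} {C : Set V} {k : ℕ}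
    (hΦ : FWW Φ C k) {K : Set V} (hK : IsCompact K) (hinv : ∀ z ∈ K, ∀ t, Φ t z ∈ K) :
    ∃ ε M : ℝ, UniformlyPositive Φ C k K ε M := by
  have h := hΦ.contDiff
  obtain ⟨M, hM1, hM⟩ := exists_norm_spaceDeriv_le h hK 1
  have hcont : Continuous fun p : V × V => spaceDeriv Φ 1 p.1 p.2 :=
    ((continuous_spaceDeriv h).comp (continuous_const.prodMk continuous_fst)).clm_apply
      continuous_snd
  have hS : IsCompact (K ×ˢ (Metric.sphere (0 : V) 1 ∩ C)) :=
    hK.prod ((isCompact_sphere 0 1).inter_right hΦ.isKCone.isClosed)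
  obtain ⟨ε, hε, hεC⟩ := (hS.image hcont).exists_cthickening_subset_open
    (isOpen_interior (s := C)) (by
      rintro _ ⟨⟨z, v⟩, ⟨hz, hv, hvC⟩, rfl⟩
      refine hΦ.spaceDeriv_mem z 1 one_pos v hvC fun h0 => ?_
      simp [h0] at hv)
  refine ⟨ε, M, hΦ.isKCone, h, hK, hinv, hΦ.mem_cone, hε, hM1, fun z hz v hv w hw => ?_, hM⟩
  by_cases hv0 : v = 0
  · have : w = 0 := by simpa [hv0] using hw
    rw [hv0, this, map_zero, add_zero]
    exact hΦ.isKCone.zero_mem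
  have hn : 0 < ‖v‖ := norm_pos_iff.2 hv0
  have hunit : ‖‖v‖⁻¹ • v‖ = 1 := by
    rw [norm_smul, norm_inv, norm_norm, inv_mul_cancel₀ hn.ne']
  have hmem : spaceDeriv Φ 1 z (‖v‖⁻¹ • v) + ‖v‖⁻¹ • w ∈ C := by
    refine interior_subset (hεC ?_)
    refine Metric.mem_cthickening_of_dist_le _ (spaceDeriv Φ 1 z (‖v‖⁻¹ • v)) _ _
      ⟨(z, ‖v‖⁻¹ • v), ⟨hz, by simpa using hunit, hΦ.isKCone.smul_mem v hv _⟩, rfl⟩ ?_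
    rw [dist_eq_norm, add_sub_cancel_left, norm_smul, norm_inv, norm_norm, inv_mul_le_iff₀ hn,
      mul_comm]
    exact hw
  have := hΦ.isKCone.smul_mem _ hmem ‖v‖
  rwa [map_smul, ← smul_add, smul_smul, mul_inv_cancel₀ hn.ne', one_smul] at this

/-! ### Vectors whose backward orbit stays in the cone -/

/-- The vectors at `z` whose backward orbit under the linearized flow stays in the cone. -/
def coneCore (Φ : Flow ℝ V) (C : Set V) (z : V) : Set V :=
  {v | ∀ n : ℕ, spaceDeriv Φ (-n) z v ∈ C}

theorem mem_of_mem_coneCore {Φ : Flow ℝ V} {C : Set V} {z v : V} (hv : v ∈ coneCore Φ C z) :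
    v ∈ C := by
  simpa [spaceDeriv_zero_apply] using hv 0

namespace UniformlyPositive

variable {Φ : Flow ℝ V} {C : Set V} {k : ℕ} {K : Set V} {ε M : ℝ}

theorem spaceDeriv_mem_coneCore (hU : UniformlyPositive Φ C k K ε M) {z v : V}
    (hv : v ∈ coneCore Φ C z) {t : ℝ} (ht : 0 ≤ t) : spaceDeriv Φ t z v ∈ coneCore Φ C (Φ t z) := by
  intro n
  rw [← spaceDeriv_add_apply hU.contDiff, add_comm, spaceDeriv_add_apply hU.contDiff]
  exact hU.mem_cone _ _ ht _ (hv n)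

theorem spaceDeriv_neg_mem_coneCore (hU : UniformlyPositive Φ C k K ε M) {z v : V}
    (hv : v ∈ coneCore Φ C z) (m : ℕ) : spaceDeriv Φ (-m) z v ∈ coneCore Φ C (Φ (-m) z) := by
  intro n
  rw [← spaceDeriv_add_apply hU.contDiff]
  have := hv (n + m)
  push_cast at this
  rwa [neg_add] at this

theorem pos (hU : UniformlyPositive Φ C k K ε M) : 0 < M := one_pos.trans_le hU.one_le

theorem le_norm (hU : UniformlyPositive Φ C k K ε M) {z : V} (hz : z ∈ K) {t : ℝ} (ht : |t| ≤ 1)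
    (v : V) : ‖v‖ ≤ M * ‖spaceDeriv Φ t z v‖ := by
  have := hU.norm_le (Φ t z) (hU.invariant z hz t) (-t) (by rwa [abs_neg]) (spaceDeriv Φ t z v)
  rwa [spaceDeriv_neg_apply hU.contDiff] at this

theorem add_mem_of_mem_coneCore (hU : UniformlyPositive Φ C k K ε M) {z : V} (hz : z ∈ K) {v : V}
    (hv : v ∈ coneCore Φ C z) {w : V} (hw : ‖w‖ ≤ ε / M * ‖v‖) : v + w ∈ C := by
  have h1 := hU.add_mem_cone (Φ (-1) z) (hU.invariant z hz _) (spaceDeriv Φ (-1) z v)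
    (by simpa using hv 1) w (by
      have h2 := hU.le_norm hz (t := -1) (by simp) v
      refine hw.trans ?_
      rw [div_mul_eq_mul_div, div_le_iff₀ hU.pos, mul_assoc]
      have := hU.eps_pos
      gcongr
      linarith)
  rwa [spaceDeriv_apply_neg hU.contDiff] at h1

/-- The frames whose span stays in `C` for `n` backward steps form a decreasing sequence of compact
sets. Each is nonempty, since a `k`-dimensional subspace of `C` at `Φ_{-n} z` can be pushed forward
to `z`. -/
theorem exists_submodule_subset_coneCore [FiniteDimensional ℝ V]
    (hU : UniformlyPositive Φ C k K ε M) (z : V) :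
    ∃ E : Submodule ℝ V, Module.finrank ℝ E = k ∧ (E : Set V) ⊆ coneCore Φ C z := by
  obtain ⟨W, hWC, hWk⟩ := hU.isKCone.isGreatest.1
  let S : ℕ → Set (Fin k → V) := fun n => frames V k ∩
    ⋂ c : Fin k → ℝ, ⋂ m : Fin (n + 1), {e | spaceDeriv Φ (-(m : ℕ)) z (∑ i, c i • e i) ∈ C}
  have hSc : ∀ n, IsClosed (⋂ c : Fin k → ℝ, ⋂ m : Fin (n + 1),
      {e : Fin k → V | spaceDeriv Φ (-(m : ℕ)) z (∑ i, c i • e i) ∈ C}) := fun n =>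
    isClosed_iInter fun c => isClosed_iInter fun m => hU.isKCone.isClosed.preimage
      (((spaceDeriv Φ (-(m : ℕ)) z).continuous).comp
        (continuous_finsetSum _ fun i _ => (continuous_apply i).const_smul (c i)))
  have hne : (⋂ n, S n).Nonempty := by
    refine IsCompact.nonempty_iInter_of_sequence_nonempty_isCompact_isClosed S ?_ ?_ ?_ ?_
    · rintro n e ⟨he, he'⟩
      refine ⟨he, Set.mem_iInter₂.2 fun c m => ?_⟩
      exact Set.mem_iInter₂.1 he' c (m.castSucc)
    · intro n
      have hfin : Module.finrank ℝ
          (W.map (spaceDeriv Φ n (Φ (-n) z) : V →ₗ[ℝ] V)) = k := by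
        rw [finrank_map_of_injective _ _ fun v _ hv =>
          eq_zero_of_spaceDeriv_eq_zero hU.contDiff hv, hWk]
      obtain ⟨e, he, hspan⟩ := exists_frame _ hfin
      refine ⟨e, he, Set.mem_iInter₂.2 fun c m => ?_⟩
      have hmem : ∑ i, c i • e i ∈ W.map (spaceDeriv Φ n (Φ (-n) z) : V →ₗ[ℝ] V) := by
        rw [← hspan]
        exact (Submodule.mem_span_range_iff_exists_fun ℝ).2 ⟨c, rfl⟩
      obtain ⟨w, hw, hwe⟩ := hmem
      have hwe' : spaceDeriv Φ n (Φ (-n) z) w = ∑ i, c i • e i := hwe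
      have hm : ((m : ℕ) : ℝ) ≤ n := by exact_mod_cast Nat.lt_succ_iff.1 m.2
      show spaceDeriv Φ (-(m : ℕ)) z (∑ i, c i • e i) ∈ C
      rw [← hwe']
      have := hU.mem_cone (Φ (-n) z) (-(m : ℕ) + n) (by linarith) w (hWC hw)
      rwa [spaceDeriv_add_apply hU.contDiff, flow_apply_neg] at this
    · exact (isCompact_frames k).inter_right (hSc 0)
    · exact fun n => (isCompact_frames k).isClosed.inter (hSc n)
  obtain ⟨e, he⟩ := hne
  rw [Set.mem_iInter] at he
  refine ⟨Submodule.span ℝ (Set.range e), finrank_span_of_mem_frames (he 0).1, fun v hv n => ?_⟩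
  obtain ⟨c, rfl⟩ := (Submodule.mem_span_range_iff_exists_fun ℝ).1 hv
  exact Set.mem_iInter₂.1 (he n).2 c (Fin.last n)

/-- Vectors of the core dominate exponentially the vectors transverse to it. -/
theorem exists_exponential_domination [FiniteDimensional ℝ V]
    (hU : UniformlyPositive Φ C k K ε M) :
    ∃ R r : ℝ, 0 < R ∧ 0 < r ∧ r < 1 ∧ ∀ z ∈ K, ∀ E : Submodule ℝ V, Module.finrank ℝ E = k →
      (E : Set V) ⊆ coneCore Φ C z → ∀ n : ℕ, ∀ v ∈ E, ∀ w, ∃ e ∈ E,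
        ‖v‖ * ‖spaceDeriv Φ n z w - spaceDeriv Φ n z e‖ ≤
          R * r ^ n * ‖spaceDeriv Φ n z v‖ * ‖w‖ := by
  have hε := hU.eps_pos
  have hM := hU.pos
  obtain ⟨c, hc1, hproj⟩ := exists_bounded_projection V
  obtain ⟨R, hR, hdom⟩ := hU.isKCone.exists_domination (div_pos hε hM)
  -- Chosen so that `δ * c * M = ε`: a perturbation of the time-one derivative by `δ` times a
  -- complementary projection stays within the cone margin.
  set δ := ε / (c * M) with hδ
  have hδ0 : 0 < δ := by positivity
  -- The perturbed product still preserves `C` and agrees with the derivative on `E`, but modulo the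
  -- image of `E` it is larger by `(1 + δ) ^ n`. Bounding it by a constant independent of `n`
  -- therefore gives exponential decay for the original product.
  have hpert : ∀ z ∈ K, ∀ E : Submodule ℝ V, ∀ n : ℕ, ∃ L : V →L[ℝ] V, (∀ v ∈ C, L v ∈ C) ∧
      (∀ v ∈ E, L v = spaceDeriv Φ n z v) ∧
      ∀ w, ∃ e ∈ E, L w = (1 + δ) ^ n • spaceDeriv Φ n z w + spaceDeriv Φ n z e := by
    intro z hz E n
    induction n with
    | zero =>
      refine ⟨ContinuousLinearMap.id ℝ V, fun v hv => hv, fun v _ => ?_, fun w => ⟨0, E.zero_mem, ?_⟩⟩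
      all_goals simp [spaceDeriv_zero_apply]
    | succ n ih =>
      obtain ⟨L, hLC, hLE, hLw⟩ := ih
      obtain ⟨π, hπE, hπid, -, hπ⟩ := hproj (E.map (spaceDeriv Φ (n + 1 : ℕ) z : V →ₗ[ℝ] V))
      set A := spaceDeriv Φ 1 (Φ n z) with hA
      have hAS : ∀ v, A (spaceDeriv Φ n z v) = spaceDeriv Φ (n + 1 : ℕ) z v := fun v => by
        rw [hA, ← spaceDeriv_add_apply hU.contDiff]
        push_cast
        rw [add_comm]
      have hzn := hU.invariant z hz n
      let L' : V →L[ℝ] V := A ∘L L + δ • (A ∘L L - π ∘L A ∘L L)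
      have hL' : ∀ v, L' v = A (L v) + δ • (A (L v) - π (A (L v))) := fun v => rfl
      refine ⟨L', fun v hv => ?_, fun v hv => ?_, fun w => ?_⟩
      · rw [hL']
        refine hU.add_mem_cone _ hzn _ (hLC v hv) _ ?_
        rw [norm_smul, Real.norm_of_nonneg hδ0.le]
        have h1 := hπ (A (L v))
        have h2 := hU.norm_le _ hzn 1 (by simp) (L v)
        calc δ * ‖A (L v) - π (A (L v))‖ ≤ δ * (c * (M * ‖L v‖)) := by
              gcongr
              exact h1.trans (by gcongr)
          _ = ε * ‖L v‖ := by rw [hδ]; field_simp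
      · have hπv : π (spaceDeriv Φ (n + 1 : ℕ) z v) = spaceDeriv Φ (n + 1 : ℕ) z v :=
          hπid _ (Submodule.mem_map.2 ⟨v, hv, rfl⟩)
        rw [hL', hLE v hv, hAS, hπv, sub_self, smul_zero, add_zero]
      · obtain ⟨e, he, hLe⟩ := hLw w
        obtain ⟨e', he', hπe⟩ := Submodule.mem_map.1 (hπE (A (L w)))
        have hπe' : spaceDeriv Φ (n + 1 : ℕ) z e' = π (A (L w)) := hπe
        refine ⟨(1 + δ) • e - δ • e', E.sub_mem (E.smul_mem _ he) (E.smul_mem _ he'), ?_⟩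
        rw [hL', ← hπe', hLe, map_add, map_smul, hAS, hAS, map_sub, map_smul, map_smul, pow_succ]
        module
  refine ⟨R, (1 + δ)⁻¹, hR, by positivity, inv_lt_one_of_one_lt₀ (by linarith), ?_⟩
  intro z hz E hEk hEC n v hv w
  obtain ⟨L, hLC, hLE, hLw⟩ := hpert z hz E n
  obtain ⟨e, he, hve⟩ := hdom L E hEk hLC (fun v hv h0 => by
    rw [hLE v hv] at h0
    exact eq_zero_of_spaceDeriv_eq_zero hU.contDiff h0)
    (fun u hu w hw => hU.add_mem_of_mem_coneCore hz (hEC hu) hw) v hv w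
  obtain ⟨e₁, he₁, hL⟩ := hLw w
  have hp : 0 < (1 + δ) ^ n := by positivity
  refine ⟨((1 + δ) ^ n)⁻¹ • (e - e₁), E.smul_mem _ (E.sub_mem he he₁), ?_⟩
  have heq : L w - L e = (1 + δ) ^ n •
      (spaceDeriv Φ n z w - spaceDeriv Φ n z (((1 + δ) ^ n)⁻¹ • (e - e₁))) := by
    rw [hL, hLE e he, map_smul, smul_sub, smul_smul, mul_inv_cancel₀ hp.ne', one_smul, map_sub]
    abel
  rw [heq, norm_smul, Real.norm_of_nonneg hp.le, hLE v hv] at hve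
  rw [inv_pow]
  have h3 : ‖v‖ * ‖spaceDeriv Φ n z w - spaceDeriv Φ n z (((1 + δ) ^ n)⁻¹ • (e - e₁))‖ =
      ((1 + δ) ^ n)⁻¹ * (‖v‖ * ((1 + δ) ^ n *
        ‖spaceDeriv Φ n z w - spaceDeriv Φ n z (((1 + δ) ^ n)⁻¹ • (e - e₁))‖)) := by
    field_simp
  rw [h3]
  calc _ ≤ ((1 + δ) ^ n)⁻¹ * (R * ‖spaceDeriv Φ n z v‖ * ‖w‖) := by gcongr
    _ = _ := by ring

end UniformlyPositive

end

section

variable {V : Type*} [NormedAddCommGroup V] [NormedSpace ℝ V]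

/-! ### The complementary bundle -/

/-- The vectors that the linearized flow at `z` makes smaller at rate `r` than all vectors
of `E`. -/
def fastSpace (Φ : Flow ℝ V) (r : ℝ) (z : V) (E : Submodule ℝ V) : Submodule ℝ V where
  carrier := {f | ∃ c : ℝ, ∀ n : ℕ, ∀ v ∈ E,
    ‖v‖ * ‖spaceDeriv Φ n z f‖ ≤ c * r ^ n * ‖spaceDeriv Φ n z v‖}
  zero_mem' := ⟨0, fun n v _ => by simp⟩
  add_mem' := by
    rintro f g ⟨a, ha⟩ ⟨b, hb⟩
    refine ⟨a + b, fun n v hv => ?_⟩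
    rw [map_add]
    have := mul_le_mul_of_nonneg_left
      (norm_add_le (spaceDeriv Φ n z f) (spaceDeriv Φ n z g)) (norm_nonneg v)
    linarith [ha n v hv, hb n v hv]
  smul_mem' := by
    rintro l f ⟨a, ha⟩
    refine ⟨‖l‖ * a, fun n v hv => ?_⟩
    rw [map_smul, norm_smul]
    have := mul_le_mul_of_nonneg_left (ha n v hv) (norm_nonneg l)
    linarith

/-- Every vector splits, with uniform bounds, into a component in a `k`-dimensional subspace of
the core and a component that is dominated by it. -/
structure SplitsUniformly (Φ : Flow ℝ V) (C : Set V) (k : ℕ) (K : Set V) (c r : ℝ) : Prop where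
  pos : 0 < c
  rate_pos : 0 < r
  rate_lt : r < 1
  exists_component : ∀ z ∈ K, ∀ E : Submodule ℝ V, Module.finrank ℝ E = k →
    (E : Set V) ⊆ coneCore Φ C z → ∀ x, ∃ u ∈ E, ∀ n : ℕ, ∀ v ∈ E,
      ‖v‖ * ‖spaceDeriv Φ n z (x - u)‖ ≤ c * r ^ n * ‖spaceDeriv Φ n z v‖ * ‖x‖

variable {Φ : Flow ℝ V} {C : Set V} {k : ℕ} {K : Set V} {ε M : ℝ}

theorem UniformlyPositive.map_spaceDeriv (hU : UniformlyPositive Φ C k K ε M) {z : V}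
    {E : Submodule ℝ V} (hEk : Module.finrank ℝ E = k) (hE : (E : Set V) ⊆ coneCore Φ C z)
    {t : ℝ} (ht : 0 ≤ t) :
    Module.finrank ℝ (E.map (spaceDeriv Φ t z : V →ₗ[ℝ] V)) = k ∧
      (E.map (spaceDeriv Φ t z : V →ₗ[ℝ] V) : Set V) ⊆ coneCore Φ C (Φ t z) := by
  refine ⟨?_, ?_⟩
  · rw [finrank_map_of_injective _ _ fun v _ hv =>
      eq_zero_of_spaceDeriv_eq_zero hU.contDiff hv, hEk]
  · rintro _ ⟨v, hv, rfl⟩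
    exact hU.spaceDeriv_mem_coneCore (hE hv) ht

theorem UniformlyPositive.map_spaceDeriv_neg (hU : UniformlyPositive Φ C k K ε M) {z : V}
    {E : Submodule ℝ V} (hEk : Module.finrank ℝ E = k) (hE : (E : Set V) ⊆ coneCore Φ C z)
    (n : ℕ) :
    Module.finrank ℝ (E.map (spaceDeriv Φ (-n) z : V →ₗ[ℝ] V)) = k ∧
      (E.map (spaceDeriv Φ (-n) z : V →ₗ[ℝ] V) : Set V) ⊆ coneCore Φ C (Φ (-n) z) := by
  refine ⟨?_, ?_⟩
  · rw [finrank_map_of_injective _ _ fun v _ hv =>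
      eq_zero_of_spaceDeriv_eq_zero hU.contDiff hv, hEk]
  · rintro _ ⟨v, hv, rfl⟩
    exact hU.spaceDeriv_neg_mem_coneCore (hE hv) n

/-- The domination available so far allows a correction in `E` depending on `n`. Here a single
correction is found as the limit of the vectors `u n` of `E` for which `S n (u n)` is the projection
of `S n x`. -/
theorem UniformlyPositive.exists_splitsUniformly [FiniteDimensional ℝ V]
    (hU : UniformlyPositive Φ C k K ε M) :
    ∃ c r : ℝ, SplitsUniformly Φ C k K c r := by
  have hM := hU.pos
  obtain ⟨c₀, hc₀, hproj⟩ := exists_bounded_projection V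
  obtain ⟨R, r, hR, hr0, hr1, hdom⟩ := hU.exists_exponential_domination
  set c₁ := R * c₀ ^ 2 * M ^ 2 with hc₁
  have h1r : 0 < 1 - r := by linarith
  refine ⟨(1 + c₁ / (1 - r)) * (c₀ * R), r, by positivity, hr0, hr1, ?_⟩
  intro z hz E hEk hEC x
  set S : ℕ → V →L[ℝ] V := fun n => spaceDeriv Φ n z with hS
  have hSadd : ∀ n m : ℕ, ∀ v, spaceDeriv Φ m (Φ n z) (S n v) = S (n + m) v := fun n m v => by
    simp only [hS]
    rw [← spaceDeriv_add_apply hU.contDiff]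
    push_cast
    rw [add_comm]
  have hSinj : ∀ n v, S n v = 0 → v = 0 := fun n v hv =>
    eq_zero_of_spaceDeriv_eq_zero hU.contDiff hv
  choose π hπE hπid hπb hπ using fun n => hproj (E.map (S n : V →ₗ[ℝ] V))
  have hex : ∀ n, ∃ u ∈ E, S n u = π n (S n x) := fun n => Submodule.mem_map.1 (hπE n (S n x))
  choose u hu hSu using hex
  set g : ℕ → V := fun n => S n x - S n (u n) with hg
  -- Up to the factor `c₀`, the vector `g n` realizes the distance from `S n x` to `S n E`.
  have hgle : ∀ n, ∀ e ∈ E, ‖g n‖ ≤ c₀ * ‖S n x - S n e‖ := fun n e he => by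
    have h1 : π n (S n e) = S n e := hπid n _ (Submodule.mem_map.2 ⟨e, he, rfl⟩)
    have h2 : g n = (S n x - S n e) - π n (S n x - S n e) := by
      simp only [hg]
      rw [map_sub, h1, hSu]
      abel
    rw [h2]
    exact hπ n _
  have hstep : ∀ n, ‖S n (u (n + 1) - u n)‖ ≤ c₀ * M ^ 2 * ‖g n‖ := fun n => by
    have hzn := hU.invariant z hz n
    have h1 : π (n + 1) (S (n + 1) (u n)) = S (n + 1) (u n) :=
      hπid (n + 1) _ (Submodule.mem_map.2 ⟨u n, hu n, rfl⟩)
    have h2 : spaceDeriv Φ (1 : ℕ) (Φ n z) (g n) = S (n + 1) x - S (n + 1) (u n) := by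
      simp only [hg]
      rw [map_sub, hSadd, hSadd]
    have h3 : S (n + 1) (u (n + 1) - u n) = π (n + 1) (spaceDeriv Φ (1 : ℕ) (Φ n z) (g n)) := by
      rw [h2, map_sub, map_sub, h1, hSu]
    have h4 : ‖S (n + 1) (u (n + 1) - u n)‖ ≤ c₀ * (M * ‖g n‖) := by
      rw [h3]
      refine (hπb (n + 1) _).trans ?_
      have := hU.norm_le _ hzn (1 : ℕ) (by simp) (g n)
      gcongr
    have h5 := hU.le_norm hzn (t := (1 : ℕ)) (by simp) (S n (u (n + 1) - u n))
    rw [hSadd] at h5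
    calc _ ≤ M * ‖S (n + 1) (u (n + 1) - u n)‖ := h5
      _ ≤ M * (c₀ * (M * ‖g n‖)) := by gcongr
      _ = _ := by ring
  -- Domination compares `‖S n d‖ ‖g (n + j)‖` with `r ^ j ‖S (n + j) d‖ ‖g n‖`, while `hstep`
  -- bounds `S (n + j) d` by `g (n + j)`; this last norm cancels. The case `n = 0` makes `u` Cauchy,
  -- and general `n` controls the tail of the series at time `n`.
  have hgeom : ∀ n j, ‖S n (u (n + j + 1) - u (n + j))‖ ≤ c₁ * ‖g n‖ * r ^ j := fun n j => by
    have hzn := hU.invariant z hz n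
    have hn0 : (0 : ℝ) ≤ n := Nat.cast_nonneg n
    obtain ⟨hEk', hEC'⟩ := hU.map_spaceDeriv hEk hEC hn0
    set d := u (n + j + 1) - u (n + j) with hd
    have hdE : d ∈ E := E.sub_mem (hu _) (hu _)
    obtain ⟨_, ⟨e, he, rfl⟩, h1⟩ := hdom (Φ n z) hzn _ hEk' hEC' j (S n d)
      (Submodule.mem_map.2 ⟨d, hdE, rfl⟩) (g n)
    have h2 : spaceDeriv Φ j (Φ n z) (g n) - spaceDeriv Φ j (Φ n z) (S n e) =
        S (n + j) x - S (n + j) (u n + e) := by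
      simp only [hg]
      rw [map_sub, hSadd, hSadd, hSadd, map_add]
      abel
    have h1' : ‖S n d‖ * ‖S (n + j) x - S (n + j) (u n + e)‖ ≤
        R * r ^ j * ‖S (n + j) d‖ * ‖g n‖ := by
      rw [← h2, ← hSadd]
      exact h1
    have h3 := hgle (n + j) (u n + e) (E.add_mem (hu n) he)
    have h4 := hstep (n + j)
    rw [← hd] at h4
    rcases (norm_nonneg (g (n + j))).eq_or_lt with h0 | h0
    · rw [← h0, mul_zero] at h4
      have : d = 0 := hSinj _ _ (norm_le_zero_iff.1 h4)
      rw [this, map_zero, norm_zero]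
      positivity
    · refine le_of_mul_le_mul_right ?_ h0
      calc ‖S n d‖ * ‖g (n + j)‖ ≤ ‖S n d‖ * (c₀ * ‖S (n + j) x - S (n + j) (u n + e)‖) := by gcongr
        _ = c₀ * (‖S n d‖ * ‖S (n + j) x - S (n + j) (u n + e)‖) := by ring
        _ ≤ c₀ * (R * r ^ j * ‖S (n + j) d‖ * ‖g n‖) := by gcongr
        _ ≤ c₀ * (R * r ^ j * (c₀ * M ^ 2 * ‖g (n + j)‖) * ‖g n‖) := by gcongr
        _ = c₁ * ‖g n‖ * r ^ j * ‖g (n + j)‖ := by rw [hc₁]; ring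
  have hS0 : ∀ v, S 0 v = v := fun v => by simp [hS, spaceDeriv_zero_apply]
  have hcauchy : CauchySeq u := by
    refine cauchySeq_of_le_geometric r (c₁ * ‖g 0‖) hr1 fun j => ?_
    have := hgeom 0 j
    rw [hS0, zero_add] at this
    rwa [dist_comm, dist_eq_norm]
  obtain ⟨a, ha⟩ := cauchySeq_tendsto_of_complete hcauchy
  have haE : a ∈ E := (Submodule.closed_of_finiteDimensional E).mem_of_tendsto ha
    (Eventually.of_forall hu)
  refine ⟨a, haE, fun n v hv => ?_⟩
  have hdist : ‖S n (u n) - S n a‖ ≤ c₁ * ‖g n‖ / (1 - r) := by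
    rw [← dist_eq_norm]
    refine dist_le_of_le_geometric_of_tendsto₀ r (c₁ * ‖g n‖) hr1
      (f := fun j => S n (u (n + j))) (fun j => ?_) ?_
    · rw [dist_comm, dist_eq_norm, ← map_sub]
      exact hgeom n j
    · exact ((S n).continuous.tendsto a).comp (ha.comp (tendsto_add_atTop_nat n |>.congr fun j => add_comm _ _))
  have hbound : ‖S n (x - a)‖ ≤ (1 + c₁ / (1 - r)) * ‖g n‖ := by
    have : S n (x - a) = g n + (S n (u n) - S n a) := by
      simp only [hg]
      rw [map_sub]
      abel
    rw [this]
    refine (norm_add_le _ _).trans ?_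
    rw [add_mul, one_mul, div_mul_eq_mul_div]
    gcongr
  obtain ⟨e, he, hve⟩ := hdom z hz E hEk hEC n v hv x
  have hfin : ‖v‖ * ‖g n‖ ≤ c₀ * (R * r ^ n * ‖S n v‖ * ‖x‖) :=
    calc ‖v‖ * ‖g n‖ ≤ ‖v‖ * (c₀ * ‖S n x - S n e‖) := by gcongr; exact hgle n e he
      _ = c₀ * (‖v‖ * ‖S n x - S n e‖) := by ring
      _ ≤ _ := by gcongr
  calc ‖v‖ * ‖S n (x - a)‖ ≤ ‖v‖ * ((1 + c₁ / (1 - r)) * ‖g n‖) := by gcongr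
    _ = (1 + c₁ / (1 - r)) * (‖v‖ * ‖g n‖) := by ring
    _ ≤ (1 + c₁ / (1 - r)) * (c₀ * (R * r ^ n * ‖S n v‖ * ‖x‖)) := by gcongr
    _ = _ := by ring

theorem SplitsUniformly.exists_decomposition {c r : ℝ}
    (hs : SplitsUniformly Φ C k K c r) {z : V} (hz : z ∈ K) {E : Submodule ℝ V}
    (hEk : Module.finrank ℝ E = k) (hEC : (E : Set V) ⊆ coneCore Φ C z) (x : V) :
    ∃ u ∈ E, ∃ f ∈ fastSpace Φ r z E, u + f = x := by
  obtain ⟨u, hu, h⟩ := hs.exists_component z hz E hEk hEC x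
  refine ⟨u, hu, x - u, ⟨c * ‖x‖, fun n v hv => ?_⟩, by abel⟩
  have := h n v hv
  linarith

/-- The derivatives over times `t` and `n` commute along the flow, and those over times `t` and `-t`
are bounded on `K`; so the shift, of either sign, only costs a constant. -/
theorem UniformlyPositive.spaceDeriv_mem_fastSpace
    (hU : UniformlyPositive Φ C k K ε M) {r : ℝ} {z : V} (hz : z ∈ K) {E : Submodule ℝ V} {f : V}
    (hf : f ∈ fastSpace Φ r z E) (t : ℝ) :
    spaceDeriv Φ t z f ∈ fastSpace Φ r (Φ t z) (E.map (spaceDeriv Φ t z : V →ₗ[ℝ] V)) := by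
  obtain ⟨a, ha⟩ := hf
  obtain ⟨B, hB1, hB⟩ := exists_norm_spaceDeriv_le hU.contDiff hU.isCompact |t|
  have hswap : ∀ (n : ℕ) v, spaceDeriv Φ n (Φ t z) (spaceDeriv Φ t z v) =
      spaceDeriv Φ t (Φ n z) (spaceDeriv Φ n z v) := fun n v => by
    rw [← spaceDeriv_add_apply hU.contDiff, ← spaceDeriv_add_apply hU.contDiff, add_comm]
  refine ⟨B ^ 3 * a, ?_⟩
  rintro n _ ⟨v, hv, rfl⟩
  change ‖spaceDeriv Φ t z v‖ * ‖spaceDeriv Φ n (Φ t z) (spaceDeriv Φ t z f)‖ ≤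
    B ^ 3 * a * r ^ n * ‖spaceDeriv Φ n (Φ t z) (spaceDeriv Φ t z v)‖
  have hzn := hU.invariant z hz n
  have h1 := hB z hz t le_rfl v
  have h2 := hB _ hzn t le_rfl (spaceDeriv Φ n z f)
  have h3 := hB _ (hU.invariant _ hzn t) (-t) (abs_neg t).le
    (spaceDeriv Φ t (Φ n z) (spaceDeriv Φ n z v))
  rw [spaceDeriv_neg_apply hU.contDiff] at h3
  rw [hswap, hswap]
  have h4 := ha n v hv
  -- No sign is imposed on the constant in `fastSpace`; it can be negative only if it is tested on
  -- `v = 0` alone.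
  have ha0 : 0 ≤ a * r ^ n ∨ ‖spaceDeriv Φ n z v‖ = 0 := by
    rcases (norm_nonneg (spaceDeriv Φ n z v)).eq_or_lt with h | h
    · exact Or.inr h.symm
    · left
      by_contra hneg
      push Not at hneg
      have : 0 ≤ ‖v‖ * ‖spaceDeriv Φ n z f‖ := by positivity
      nlinarith
  have h5 : a * r ^ n * ‖spaceDeriv Φ n z v‖ ≤
      a * r ^ n * (B * ‖spaceDeriv Φ t (Φ n z) (spaceDeriv Φ n z v)‖) := by
    rcases ha0 with h | h
    · gcongr
    · have hv0 : v = 0 := eq_zero_of_spaceDeriv_eq_zero hU.contDiff (norm_eq_zero.1 h)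
      simp [hv0]
  calc _ ≤ (B * ‖v‖) * (B * ‖spaceDeriv Φ n z f‖) := by gcongr
    _ = B ^ 2 * (‖v‖ * ‖spaceDeriv Φ n z f‖) := by ring
    _ ≤ B ^ 2 * (a * r ^ n * ‖spaceDeriv Φ n z v‖) := by gcongr
    _ ≤ B ^ 2 * (a * r ^ n * (B * ‖spaceDeriv Φ t (Φ n z) (spaceDeriv Φ n z v)‖)) := by gcongr
    _ = _ := by ring

theorem SplitsUniformly.exists_mul_pow_lt {c r : ℝ}
    (hs : SplitsUniformly Φ C k K c r) (a : ℝ) {b : ℝ} (hb : 0 < b) : ∃ n : ℕ, a * r ^ n < b := by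
  have h : Tendsto (fun n : ℕ => a * r ^ n) atTop (𝓝 0) := by
    simpa using (tendsto_pow_atTop_nhds_zero_of_lt_one hs.rate_pos.le hs.rate_lt).const_mul a
  exact (h.eventually (gt_mem_nhds hb)).exists

/-! ### Transversality to the cone and uniqueness of the splitting -/

section Splitting

variable (hU : UniformlyPositive Φ C k K ε M) {c r : ℝ} (hs : SplitsUniformly Φ C k K c r)
include hU hs

theorem disjoint_fastSpace (z : V) (E : Submodule ℝ V) : Disjoint E (fastSpace Φ r z E) := by
  rw [Submodule.disjoint_def]
  rintro x hx ⟨a, ha⟩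
  by_contra hx0
  have h1 : ∀ n : ℕ, ‖x‖ ≤ a * r ^ n := fun n => by
    have h2 : 0 < ‖spaceDeriv Φ n z x‖ :=
      norm_pos_iff.2 fun h => hx0 (eq_zero_of_spaceDeriv_eq_zero hU.contDiff h)
    exact le_of_mul_le_mul_right (ha n x hx) h2
  have h2 : Tendsto (fun n : ℕ => a * r ^ n) atTop (𝓝 0) := by
    simpa using (tendsto_pow_atTop_nhds_zero_of_lt_one hs.rate_pos.le hs.rate_lt).const_mul a
  exact hx0 (norm_le_zero_iff.1 (ge_of_tendsto' h2 h1))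

theorem isCompl_fastSpace {z : V} (hz : z ∈ K) {E : Submodule ℝ V}
    (hEk : Module.finrank ℝ E = k) (hEC : (E : Set V) ⊆ coneCore Φ C z) :
    IsCompl E (fastSpace Φ r z E) := by
  refine ⟨disjoint_fastSpace hU hs z E, ?_⟩
  rw [codisjoint_iff, Submodule.eq_top_iff']
  intro x
  obtain ⟨u, hu, f, hf, hx⟩ := hs.exists_decomposition hz hEk hEC x
  exact Submodule.mem_sup.2 ⟨u, hu, f, hf, hx⟩

/-- Membership in `fastSpace` allows a constant depending on `f`. Uniqueness of the decomposition
forces the `E`-component of `f` to vanish, which yields the uniform constant. -/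
theorem norm_spaceDeriv_le_of_mem_fastSpace {z : V} (hz : z ∈ K) {E : Submodule ℝ V}
    (hEk : Module.finrank ℝ E = k) (hEC : (E : Set V) ⊆ coneCore Φ C z) {f : V}
    (hf : f ∈ fastSpace Φ r z E) (n : ℕ) {v : V} (hv : v ∈ E) :
    ‖v‖ * ‖spaceDeriv Φ n z f‖ ≤ c * r ^ n * ‖spaceDeriv Φ n z v‖ * ‖f‖ := by
  obtain ⟨u, hu, h⟩ := hs.exists_component z hz E hEk hEC f
  have hfu : f - u ∈ fastSpace Φ r z E := ⟨c * ‖f‖, fun n v hv => by linarith [h n v hv]⟩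
  have huF : u ∈ fastSpace Φ r z E := by
    have := Submodule.sub_mem _ hf hfu
    rwa [sub_sub_cancel] at this
  have hu0 : u = 0 := Submodule.disjoint_def.1 (disjoint_fastSpace hU hs z E) u hu huF
  simpa [hu0] using h n v hv

/-- Otherwise, after enough steps, the images of `E` and `f` span a `(k + 1)`-dimensional subspace
of `C`. For `u` in `E` short relative to `f`, the sum `u + f` enters `C` after one step by the
margin around `f`; for `u` long, `f` has become small relative to `u`, whose image has a margin as a
core vector. -/
theorem eq_zero_of_mem_fastSpace_of_mem_cone [FiniteDimensional ℝ V] {z : V} (hz : z ∈ K)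
    {E : Submodule ℝ V}
    (hEk : Module.finrank ℝ E = k) (hEC : (E : Set V) ⊆ coneCore Φ C z) {f : V}
    (hf : f ∈ fastSpace Φ r z E) (hfC : f ∈ C) : f = 0 := by
  by_contra hf0
  have hM := hU.pos
  have hε := hU.eps_pos
  have hfpos : 0 < ‖f‖ := norm_pos_iff.2 hf0
  obtain ⟨n, hn⟩ := hs.exists_mul_pow_lt (c * M / ε * r) (div_pos hε hM)
  set S := spaceDeriv Φ (n + 1 : ℕ) z with hS
  have hsplit : ∀ v, S v = spaceDeriv Φ n (Φ 1 z) (spaceDeriv Φ 1 z v) := fun v => by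
    rw [hS, ← spaceDeriv_add_apply hU.contDiff]
    push_cast
    rfl
  obtain ⟨hk', hC'⟩ := hU.map_spaceDeriv hEk hEC (t := (n + 1 : ℕ)) (Nat.cast_nonneg _)
  have hzn := hU.invariant z hz (n + 1 : ℕ)
  have hnot : S f ∉ E.map (S : V →ₗ[ℝ] V) := fun hmem => by
    have h0 := Submodule.disjoint_def.1 (disjoint_fastSpace hU hs _ _) _ hmem
      (hU.spaceDeriv_mem_fastSpace hz hf _)
    exact hf0 (eq_zero_of_spaceDeriv_eq_zero hU.contDiff h0)
  have hrank := Submodule.finrank_sup_span_singleton hnot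
  rw [hk'] at hrank
  have hsum : ∀ u ∈ E, S u + S f ∈ C := by
    intro u hu
    by_cases hcase : ‖spaceDeriv Φ 1 z u‖ ≤ ε * ‖f‖
    · have h1 := hU.add_mem_cone z hz f hfC _ hcase
      rw [add_comm, ← map_add] at h1
      rw [← map_add, hsplit]
      refine hU.mem_cone _ _ (Nat.cast_nonneg n) _ ?_
      exact h1
    · push Not at hcase
      refine hU.add_mem_of_mem_coneCore hzn (hC' (Submodule.mem_map.2 ⟨u, hu, rfl⟩)) ?_
      change ‖S f‖ ≤ ε / M * ‖S u‖
      have h1 := hU.norm_le z hz 1 (by simp) u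
      have h2 : ε * ‖f‖ ≤ M * ‖u‖ := by linarith
      have h3 := norm_spaceDeriv_le_of_mem_fastSpace hU hs hz hEk hEC hf (n + 1) hu
      have hu0 : 0 < ‖u‖ := by
        by_contra h
        have : ‖u‖ = 0 := le_antisymm (not_lt.1 h) (norm_nonneg _)
        rw [this, mul_zero] at h2
        have : 0 < ε * ‖f‖ := by positivity
        linarith
      refine le_of_mul_le_mul_left ?_ hu0
      have hcr : 0 ≤ c * r ^ (n + 1) := mul_nonneg hs.pos.le (pow_nonneg hs.rate_pos.le _)
      have h4 : ‖f‖ ≤ M * ‖u‖ / ε := by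
        rw [le_div_iff₀ hε]
        linarith
      calc ‖u‖ * ‖S f‖ ≤ c * r ^ (n + 1) * ‖S u‖ * ‖f‖ := h3
        _ ≤ c * r ^ (n + 1) * ‖S u‖ * (M * ‖u‖ / ε) := by gcongr
        _ = (c * M / ε * r * r ^ n) * (‖u‖ * ‖S u‖) := by rw [pow_succ]; ring
        _ ≤ (ε / M) * (‖u‖ * ‖S u‖) := by gcongr
        _ = _ := by ring
  have hsub : ((E.map (S : V →ₗ[ℝ] V) ⊔ Submodule.span ℝ {S f} : Submodule ℝ V) : Set V) ⊆ C := by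
    intro p hp
    obtain ⟨_, ⟨u, hu, rfl⟩, q, hq, rfl⟩ := Submodule.mem_sup.1 hp
    obtain ⟨t, rfl⟩ := Submodule.mem_span_singleton.1 hq
    by_cases ht : t = 0
    · rw [ht, zero_smul, add_zero]
      exact mem_of_mem_coneCore (hC' (Submodule.mem_map.2 ⟨u, hu, rfl⟩))
    · have h1 := hU.isKCone.smul_mem _ (hsum (t⁻¹ • u) (E.smul_mem _ hu)) t
      rwa [map_smul, smul_add, smul_smul, mul_inv_cancel₀ ht, one_smul] at h1
  have := hU.isKCone.isGreatest.2 ⟨_, hsub, hrank⟩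
  omega

/-- The core at a point of `K` is the unique `k`-dimensional subspace it contains. -/
theorem coneCore_subset [FiniteDimensional ℝ V] {z : V} (hz : z ∈ K) {E : Submodule ℝ V}
    (hEk : Module.finrank ℝ E = k) (hEC : (E : Set V) ⊆ coneCore Φ C z) :
    coneCore Φ C z ⊆ E := by
  intro v hv
  have hM := hU.pos
  have hε := hU.eps_pos
  obtain ⟨u₀, hu₀, f₀, hf₀, rfl⟩ := hs.exists_decomposition hz hEk hEC v
  by_cases hf0 : f₀ = 0
  · simpa [hf0] using hu₀
  exfalso
  have hfpos : 0 < ‖f₀‖ := norm_pos_iff.2 hf0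
  -- Domination reversed in time: `n` steps back, the `E`-component has norm at most `q` times that
  -- of the fast component. The bound `1 / 2` lets the fast component be controlled by the sum, the
  -- bound `ε / (2 M)` fits the cone margin.
  obtain ⟨n, hn⟩ := hs.exists_mul_pow_lt (c * ‖u₀‖ / ‖f₀‖)
    (lt_min one_half_pos (div_pos hε (mul_pos two_pos hM)))
  obtain ⟨hn2, hnε⟩ := lt_min_iff.1 hn
  set q := c * ‖u₀‖ / ‖f₀‖ * r ^ n with hq
  have hq0 : 0 ≤ q := by
    have := hs.pos
    have := hs.rate_pos
    positivity
  have hzn := hU.invariant z hz (-n)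
  obtain ⟨hk', hC'⟩ := hU.map_spaceDeriv_neg hEk hEC n
  set E' := E.map (spaceDeriv Φ (-n) z : V →ₗ[ℝ] V) with hE'
  obtain ⟨u, hu, f, hf, huf⟩ := hs.exists_decomposition hzn hk' hC' (spaceDeriv Φ (-n) z (u₀ + f₀))
  have hmapE : E'.map (spaceDeriv Φ n (Φ (-n) z) : V →ₗ[ℝ] V) = E := by
    ext y
    constructor
    · rintro ⟨_, ⟨y', hy', rfl⟩, rfl⟩
      have : spaceDeriv Φ n (Φ (-n) z) (spaceDeriv Φ (-n) z y') = y' :=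
        spaceDeriv_apply_neg hU.contDiff n z y'
      change spaceDeriv Φ n (Φ (-n) z) (spaceDeriv Φ (-n) z y') ∈ E
      rwa [this]
    · intro hy
      exact ⟨spaceDeriv Φ (-n) z y, ⟨y, hy, rfl⟩, spaceDeriv_apply_neg hU.contDiff n z y⟩
  have hSf : spaceDeriv Φ n (Φ (-n) z) f ∈ fastSpace Φ r z E := by
    have := hU.spaceDeriv_mem_fastSpace hzn hf n
    rwa [hmapE, flow_apply_neg] at this
  have hSu : spaceDeriv Φ n (Φ (-n) z) u ∈ E := by
    rw [← hmapE]
    exact ⟨u, hu, rfl⟩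
  have hsum : spaceDeriv Φ n (Φ (-n) z) u + spaceDeriv Φ n (Φ (-n) z) f = u₀ + f₀ := by
    rw [← map_add, huf, spaceDeriv_apply_neg hU.contDiff]
  have hdiff : u₀ - spaceDeriv Φ n (Φ (-n) z) u = spaceDeriv Φ n (Φ (-n) z) f - f₀ := by
    rw [sub_eq_sub_iff_add_eq_add, ← hsum]
    abel
  have hzero : u₀ - spaceDeriv Φ n (Φ (-n) z) u = 0 := by
    refine Submodule.disjoint_def.1 (disjoint_fastSpace hU hs z E) _ (E.sub_mem hu₀ hSu) ?_
    rw [hdiff]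
    exact Submodule.sub_mem _ hSf hf₀
  have hu₀' : spaceDeriv Φ n (Φ (-n) z) u = u₀ := (sub_eq_zero.1 hzero).symm
  have hf₀' : spaceDeriv Φ n (Φ (-n) z) f = f₀ := by
    rw [hdiff] at hzero
    exact sub_eq_zero.1 hzero
  have h1 := norm_spaceDeriv_le_of_mem_fastSpace hU hs hzn hk' hC' hf n hu
  rw [hu₀', hf₀'] at h1
  have h2 : ‖u‖ ≤ q * ‖f‖ := by
    rw [← le_div_iff₀ hfpos] at h1
    exact h1.trans (le_of_eq (by rw [hq]; ring))
  have hvn : spaceDeriv Φ (-n) z (u₀ + f₀) ∈ C := hv n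
  have h3 : ‖f‖ ≤ ‖u + f‖ + ‖u‖ := by simpa using norm_sub_le (u + f) u
  have h4 : ‖u‖ ≤ 2 * q * ‖u + f‖ := by nlinarith [norm_nonneg u, norm_nonneg f]
  have h5 : M * ‖u‖ ≤ ε * ‖u + f‖ := by
    have : 2 * M * q ≤ ε := by
      rw [lt_div_iff₀ (by positivity)] at hnε
      linarith
    calc M * ‖u‖ ≤ M * (2 * q * ‖u + f‖) := by gcongr
      _ = 2 * M * q * ‖u + f‖ := by ring
      _ ≤ _ := by gcongr
  rw [← huf] at hvn
  -- The pulled-back vector `u + f` lies in `C` and `u` is within the margin, so removing the image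
  -- of `u` after one step leaves the image of `f` in `C`. A fast vector there must vanish.
  have h6 := hU.add_mem_cone _ hzn _ hvn (-spaceDeriv Φ 1 (Φ (-n) z) u) (by
    rw [norm_neg]
    exact (hU.norm_le _ hzn 1 (by simp) u).trans h5)
  rw [map_add, add_neg_eq_iff_eq_add.2 (add_comm _ _)] at h6
  obtain ⟨hk'', hC''⟩ := hU.map_spaceDeriv hk' hC' zero_le_one
  have h7 := eq_zero_of_mem_fastSpace_of_mem_cone hU hs (hU.invariant _ hzn 1) hk'' hC''
    (hU.spaceDeriv_mem_fastSpace hzn hf 1) h6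
  have h8 : f = 0 := eq_zero_of_spaceDeriv_eq_zero hU.contDiff h7
  rw [h8, map_zero] at hf₀'
  exact hf0 hf₀'.symm

end Splitting

end

section

variable {V : Type*} [NormedAddCommGroup V] [NormedSpace ℝ V]

/-! ### Existence of exponential separations -/

theorem tendsto_spaceDeriv_apply {Φ : Flow ℝ V}
    (h : ContDiff ℝ 1 (fun p : ℝ × V => Φ p.1 p.2)) (t : ℝ) {ι : Type*} {l : Filter ι}
    {z v : ι → V} {z₀ v₀ : V} (hz : Tendsto z l (𝓝 z₀)) (hv : Tendsto v l (𝓝 v₀)) :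
    Tendsto (fun j => spaceDeriv Φ t (z j) (v j)) l (𝓝 (spaceDeriv Φ t z₀ v₀)) := by
  have hcont : Continuous fun p : V × V => spaceDeriv Φ t p.1 p.2 :=
    ((continuous_spaceDeriv h).comp (continuous_const.prodMk continuous_fst)).clm_apply
      continuous_snd
  exact (hcont.tendsto (z₀, v₀)).comp (hz.prodMk_nhds hv)

section Splitting

variable {Φ : Flow ℝ V} {C : Set V} {k : ℕ} {K : Set V} {ε M : ℝ}

theorem UniformlyPositive.hasClosedGraph_coneCore (hU : UniformlyPositive Φ C k K ε M)
    {E : V → Submodule ℝ V} (hE : ∀ z ∈ K, (E z : Set V) = coneCore Φ C z) :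
    HasClosedGraph K E := by
  intro z z₀ hz hz₀ hlim v v₀ hv hvlim
  rw [← SetLike.mem_coe, hE z₀ hz₀]
  refine fun n => hU.isKCone.isClosed.mem_of_tendsto
    (tendsto_spaceDeriv_apply hU.contDiff (-n) hlim hvlim) (Eventually.of_forall fun j => ?_)
  have := hv j
  rw [← SetLike.mem_coe, hE _ (hz j)] at this
  exact this n

variable [FiniteDimensional ℝ V] {c r : ℝ}

/-- If the limit `f₀` had a nonzero component in `E`, that component would eventually dominate and
carry `f₀` into the interior of `C`. Nearby fast vectors would then enter `C` as well, so they would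
vanish, and so would `f₀`. -/
theorem SplitsUniformly.hasClosedGraph_fastSpace (hU : UniformlyPositive Φ C k K ε M)
    (hs : SplitsUniformly Φ C k K c r) {E : V → Submodule ℝ V}
    (hEk : ∀ z, Module.finrank ℝ (E z) = k) (hEC : ∀ z, (E z : Set V) ⊆ coneCore Φ C z) :
    HasClosedGraph K (fun z => fastSpace Φ r z (E z)) := by
  intro z z₀ hz hz₀ hlim f f₀ hf hflim
  obtain ⟨u, hu, g, hg, hug⟩ := hs.exists_decomposition hz₀ (hEk z₀) (hEC z₀) f₀
  by_cases hu0 : u = 0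
  · rw [← hug, hu0, zero_add]
    exact hg
  have hupos : 0 < ‖u‖ := norm_pos_iff.2 hu0
  have hpos : 0 < ε / M := div_pos hU.eps_pos hU.pos
  obtain ⟨n, hn⟩ := hs.exists_mul_pow_lt (c * ‖g‖) (mul_pos hpos hupos)
  have hSu : 0 < ‖spaceDeriv Φ n z₀ u‖ := norm_pos_iff.2 fun h =>
    hu0 (eq_zero_of_spaceDeriv_eq_zero hU.contDiff h)
  have hsmall : ‖spaceDeriv Φ n z₀ g‖ < ε / M * ‖spaceDeriv Φ n z₀ u‖ := by
    have h1 := norm_spaceDeriv_le_of_mem_fastSpace hU hs hz₀ (hEk z₀) (hEC z₀) hg n hu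
    refine lt_of_mul_lt_mul_left ?_ hupos.le
    calc ‖u‖ * ‖spaceDeriv Φ n z₀ g‖ ≤ c * ‖g‖ * r ^ n * ‖spaceDeriv Φ n z₀ u‖ := by linarith
      _ < ε / M * ‖u‖ * ‖spaceDeriv Φ n z₀ u‖ := by gcongr
      _ = _ := by ring
  have hzn := hU.invariant z₀ hz₀ n
  have hcore : spaceDeriv Φ n z₀ u ∈ coneCore Φ C (Φ n z₀) :=
    hU.spaceDeriv_mem_coneCore (hEC z₀ hu) (Nat.cast_nonneg n)
  have hnhds : C ∈ 𝓝 (spaceDeriv Φ n z₀ f₀) := by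
    refine mem_of_superset (Metric.isOpen_ball.mem_nhds (x := spaceDeriv Φ n z₀ f₀)
      (s := Metric.ball (spaceDeriv Φ n z₀ u) (ε / M * ‖spaceDeriv Φ n z₀ u‖)) ?_) ?_
    · rw [mem_ball_iff_norm, ← hug, map_add, add_sub_cancel_left]
      exact hsmall
    · intro y hy
      have := hU.add_mem_of_mem_coneCore hzn hcore (mem_ball_iff_norm.1 hy).le
      rwa [add_sub_cancel] at this
  have hev := (tendsto_spaceDeriv_apply hU.contDiff n hlim hflim).eventually_mem hnhds
  have hzero : ∀ᶠ j in atTop, f j = 0 := by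
    filter_upwards [hev] with j hj
    obtain ⟨hk', hC'⟩ := hU.map_spaceDeriv (hEk (z j)) (hEC (z j)) (t := n) (Nat.cast_nonneg n)
    exact eq_zero_of_spaceDeriv_eq_zero hU.contDiff
      (eq_zero_of_mem_fastSpace_of_mem_cone hU hs (hU.invariant _ (hz j) n) hk' hC'
        (hU.spaceDeriv_mem_fastSpace (hz j) (hf j) n) hj)
  have : f₀ = 0 := tendsto_nhds_unique hflim (tendsto_const_nhds.congr' (hzero.mono fun j h => h.symm))
  rw [this]
  exact Submodule.zero_mem _

theorem FWW.exists_isExponentialSeparation (hΦ : FWW Φ C k) (hK : IsCompact K)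
    (hinv : ∀ z ∈ K, ∀ t, Φ t z ∈ K) :
    ∃ E F : V → Submodule ℝ V, IsExponentialSeparation Φ C k K E F := by
  obtain ⟨ε, M, hU⟩ := hΦ.uniformlyPositive hK hinv
  obtain ⟨c, r, hs⟩ := hU.exists_splitsUniformly
  choose E hEk hEC using hU.exists_submodule_subset_coneCore
  have hEeq : ∀ z ∈ K, (E z : Set V) = coneCore Φ C z := fun z hz =>
    (hEC z).antisymm (coneCore_subset hU hs hz (hEk z) (hEC z))
  have hcompl : ∀ z ∈ K, IsCompl (E z) (fastSpace Φ r z (E z)) := fun z hz =>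
    isCompl_fastSpace hU hs hz (hEk z) (hEC z)
  have hmap : ∀ z ∈ K, ∀ t : ℝ, 0 < t →
      (E z).map (spaceDeriv Φ t z : V →ₗ[ℝ] V) = E (Φ t z) := fun z hz t ht => by
    obtain ⟨hk', hC'⟩ := hU.map_spaceDeriv (hEk z) (hEC z) ht.le
    refine Submodule.eq_of_le_of_finrank_eq ?_ (by rw [hk', hEk])
    intro v hv
    rw [← SetLike.mem_coe, hEeq _ (hinv z hz t)]
    exact hC' hv
  refine ⟨E, fun z => fastSpace Φ r z (E z),
    (hU.hasClosedGraph_coneCore hEeq).isContinuousBundle fun z _ => hEk z,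
    (hs.hasClosedGraph_fastSpace hU hEk hEC).isContinuousBundle fun z hz => ?_, hcompl, hmap,
    fun z hz t ht => ?_, ?_, fun z hz v hv => ?_, fun z hz => ?_⟩
  · have := Submodule.finrank_add_eq_of_isCompl (hcompl z hz)
    rw [hEk] at this
    omega
  · rintro _ ⟨f, hf, rfl⟩
    rw [← hmap z hz t ht]
    exact hU.spaceDeriv_mem_fastSpace hz hf t
  · have hM := hU.pos
    have hr := hs.rate_pos
    have hc := hs.pos
    -- Passing from time `⌊t⌋₊` to `t` costs a factor `M` for each of the two vectors; `1 / r` comes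
    -- from `r ^ ⌊t⌋₊ ≤ r ^ t / r`.
    refine ⟨M ^ 2 * c / r, r, by positivity, hr, hs.rate_lt, ?_⟩
    intro z hz w hw hw1 v hv hv1 t ht
    set n := ⌊t⌋₊ with hn
    have hnt : (n : ℝ) ≤ t := Nat.floor_le ht
    have htn : t < n + 1 := Nat.lt_floor_add_one t
    have hsplit : ∀ y, spaceDeriv Φ t z y = spaceDeriv Φ (t - n) (Φ n z) (spaceDeriv Φ n z y) :=
      fun y => by rw [← spaceDeriv_add_apply hU.contDiff, sub_add_cancel]
    have habs : |t - n| ≤ 1 := by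
      rw [abs_le]
      constructor <;> linarith
    have hzn := hinv z hz n
    have h1 := hU.norm_le _ hzn _ habs (spaceDeriv Φ n z w)
    have h2 := hU.le_norm hzn habs (spaceDeriv Φ n z v)
    have h3 := norm_spaceDeriv_le_of_mem_fastSpace hU hs hz (hEk z) (hEC z) hw n hv
    rw [hv1, hw1, one_mul, mul_one] at h3
    have h4 : r ^ n ≤ r ^ t / r := by
      rw [le_div_iff₀ hr, ← pow_succ, ← Real.rpow_natCast]
      refine Real.rpow_le_rpow_of_exponent_ge hr hs.rate_lt.le ?_
      push_cast
      exact htn.le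
    rw [hsplit w, hsplit v]
    calc _ ≤ M * ‖spaceDeriv Φ n z w‖ := h1
      _ ≤ M * (c * r ^ n * ‖spaceDeriv Φ n z v‖) := by gcongr
      _ ≤ M * (c * (r ^ t / r) * (M * ‖spaceDeriv Φ (t - n) (Φ n z) (spaceDeriv Φ n z v)‖)) := by
        gcongr
      _ = _ := by ring
  · by_cases hv0 : v = 0
    · exact Or.inr hv0
    · left
      have h1 : spaceDeriv Φ (-1) z v ∈ C := by simpa using hEC z hv 1
      have h2 := hΦ.spaceDeriv_mem (Φ (-1) z) 1 one_pos _ h1 fun h0 =>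
        hv0 (eq_zero_of_spaceDeriv_eq_zero hU.contDiff h0)
      rwa [spaceDeriv_apply_neg hU.contDiff] at h2
  · refine Set.Subset.antisymm ?_ ?_
    · rintro f ⟨hf, hfC⟩
      exact eq_zero_of_mem_fastSpace_of_mem_cone hU hs hz (hEk z) (hEC z) hf hfC
    · rintro _ rfl
      exact ⟨Submodule.zero_mem _, hΦ.isKCone.zero_mem⟩

end Splitting

end

section

/-! ### Omega limit sets -/

section

variable {V : Type*} [NormedAddCommGroup V]

theorem mem_forwardOrbit (Φ : Flow ℝ V) (x : V) {t : ℝ} (ht : 0 ≤ t) :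
    Φ t x ∈ Φ.forwardOrbit x :=
  ⟨⟨t, ht⟩, rfl⟩

theorem omega_invariant (Φ : Flow ℝ V) (x : V) : ∀ z ∈ omega Φ x, ∀ t, Φ t z ∈ omega Φ x :=
  fun _ hz t => Φ.isInvariant_omegaLimit atTop {x} (fun s => tendsto_atTop_add_const_left _ s tendsto_id)
    t hz

end

variable {V : Type*} [NormedAddCommGroup V] [NormedSpace ℝ V]

section Bounded

variable [FiniteDimensional ℝ V] {Φ : Flow ℝ V} {x : V}

theorem isCompact_closure_forwardOrbit (hb : Bornology.IsBounded (Φ.forwardOrbit x)) :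
    IsCompact (closure (Φ.forwardOrbit x)) :=
  Metric.isCompact_of_isClosed_isBounded isClosed_closure hb.closure

theorem isCompact_omega (hb : Bornology.IsBounded (Φ.forwardOrbit x)) :
    IsCompact (omega Φ x) := by
  refine (isCompact_closure_forwardOrbit hb).of_isClosed_subset (isClosed_omegaLimit _ _ _) ?_
  refine (omegaLimit_subset_closure_image2 atTop Φ {x} (Ici_mem_atTop 0)).trans
    (closure_mono ?_)
  rintro _ ⟨t, ht, _, rfl, rfl⟩
  exact mem_forwardOrbit Φ _ ht

theorem eventually_mem_of_omega_subset (hb : Bornology.IsBounded (Φ.forwardOrbit x)) {U : Set V}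
    (hU : IsOpen U) (hsub : omega Φ x ⊆ U) : ∀ᶠ t in atTop, Φ t x ∈ U := by
  have h := eventually_mapsTo_of_isCompact_absorbing_of_isOpen_of_omegaLimit_subset atTop Φ {x}
    (isCompact_closure_forwardOrbit hb) (by
      filter_upwards [Ici_mem_atTop (0 : ℝ)] with t ht
      rintro _ rfl
      exact subset_closure (mem_forwardOrbit Φ _ ht)) hU hsub
  filter_upwards [h] with t ht using ht rfl

/-! ### Stability along the cone -/

/-- Away from the closure of the pseudo-ordered points, bounded orbits are stable with respect to
perturbations in the direction of the cone. -/
theorem stable_of_notMem_closure_pseudoOrdered {C : Set V} (hCc : IsClosed C)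
    (hmono : StronglyMonotone Φ C)
    (hb : Bornology.IsBounded (Φ.forwardOrbit x)) (hx : x ∉ closure (pseudoOrdered Φ C))
    {δ : ℝ} (hδ : 0 < δ) :
    ∃ ρ > 0, ∀ y, Ordered C y x → ‖y - x‖ < ρ → ∀ t, 0 ≤ t → ‖Φ t y - Φ t x‖ < δ := by
  by_contra! hcon
  have hH := isCompact_closure_forwardOrbit hb
  set H := closure (Φ.forwardOrbit x) with hHdef
  -- uniform strength of the order after unit time, for pairs at distance `δ`
  obtain ⟨ε, hε, hεC⟩ : ∃ ε > 0, ∀ b ∈ H, ∀ u ∈ C, ‖u‖ = δ → ∀ w, ‖w‖ < ε →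
      Φ 1 (b + u) - Φ 1 b + w ∈ C ∧ Φ 1 (b + u) - Φ 1 b + w ≠ 0 := by
    have hcont : Continuous fun p : V × V => Φ 1 (p.1 + p.2) - Φ 1 p.1 := by
      have := Φ.continuous_toFun 1
      fun_prop
    obtain ⟨ε, hε, hsub⟩ := ((hH.prod ((isCompact_sphere (0 : V) δ).inter_right hCc)).image
      hcont).exists_thickening_subset_open
      ((isOpen_interior (s := C)).inter (isOpen_compl_singleton (x := (0 : V)))) (by
        rintro _ ⟨⟨b, u⟩, ⟨hbH, hu, huC⟩, rfl⟩
        have hu0 : u ≠ 0 := by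
          rintro rfl
          simp [hδ.ne] at hu
        refine ⟨hmono.strongly (b + u) b (by simpa using hu0) ?_ 1 one_pos, ?_⟩
        · simpa [Ordered] using huC
        · simp only [Set.mem_compl_iff, Set.mem_singleton_iff, sub_eq_zero]
          intro h
          have := flow_injective Φ 1 h
          exact hu0 (by simpa using this))
    refine ⟨ε, hε, fun b hbH u hu huδ w hw => ?_⟩
    have h1 := hsub (Metric.mem_thickening_iff.2 ⟨Φ 1 (b + u) - Φ 1 b,
      ⟨(b, u), ⟨hbH, by simpa using huδ, hu⟩, rfl⟩, by
        show dist (Φ 1 (b + u) - Φ 1 b + w) _ < ε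
        rwa [dist_eq_norm, add_sub_cancel_left]⟩)
    exact ⟨interior_subset h1.1, h1.2⟩
  -- By the intermediate value theorem the perturbed orbits can be stopped when their distance from
  -- the orbit of `x` is exactly `δ`, which places the difference in a compact set.
  have hex : ∀ n : ℕ, ∃ y t, Ordered C y x ∧ ‖y - x‖ < 1 / ((n : ℝ) + 1) ∧ 0 ≤ t ∧
      ‖Φ t y - Φ t x‖ = δ := fun n => by
    obtain ⟨y, hyC, hy, t, ht, hty⟩ := hcon (min δ (1 / ((n : ℝ) + 1)))
      (lt_min hδ (by positivity))
    have hcont : ContinuousOn (fun s => ‖Φ s y - Φ s x‖) (Set.Icc 0 t) :=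
      ((Φ.continuous continuous_id continuous_const).sub
        (Φ.continuous continuous_id continuous_const)).norm.continuousOn
    have h0 : ‖Φ 0 y - Φ 0 x‖ ≤ δ := by
      rw [Φ.map_zero]
      exact (hy.trans_le (min_le_left _ _)).le
    obtain ⟨s, hs, hsδ⟩ := intermediate_value_Icc ht hcont ⟨h0, hty⟩
    exact ⟨y, s, hyC, hy.trans_le (min_le_right _ _), hs.1, hsδ⟩
  choose y t hyC hy ht hyt using hex
  have hylim : Tendsto y atTop (𝓝 x) := by
    rw [tendsto_iff_norm_sub_tendsto_zero]
    exact squeeze_zero (fun n => norm_nonneg _) (fun n => (hy n).le)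
      tendsto_one_div_add_atTop_nhds_zero_nat
  obtain ⟨q, -, φ, hφ, hq⟩ := hH.tendsto_subseq (x := fun n => Φ (t n + 1) x) fun n =>
    subset_closure (mem_forwardOrbit Φ x (by linarith [ht n]))
  refine hx (mem_closure_iff_nhds.2 fun N hN => ?_)
  have hball := hq.eventually (Metric.ball_mem_nhds q (ε := ε / 3) (by positivity))
  -- The order of choice matters: `m` is fixed first, so that `y (φ n)` can be taken close enough to
  -- `x` to follow it up to the time attached to `m`.
  obtain ⟨m, hm⟩ := hball.exists
  have hyφ := hylim.comp hφ.tendsto_atTop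
  have hm' : ∀ᶠ n in atTop, dist (Φ (t (φ m) + 1) (y (φ n))) (Φ (t (φ m) + 1) x) < ε / 3 :=
    (((Φ.continuous_toFun (t (φ m) + 1)).tendsto x).comp hyφ).eventually
      (Metric.ball_mem_nhds _ (by positivity))
  obtain ⟨n, hn, hn', hnN⟩ := (hball.and (hm'.and (hyφ.eventually_mem hN))).exists
  refine ⟨y (φ n), hnN, ?_⟩
  set p := Φ (t (φ n) + 1) (y (φ n)) with hp
  set p' := Φ (t (φ m) + 1) (y (φ n)) with hp'
  set a := Φ (t (φ n) + 1) x with ha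
  set a' := Φ (t (φ m) + 1) x with ha'
  have hw : ‖(a - a') + (a' - p')‖ < ε := by
    have h1 : dist a q < ε / 3 := hn
    have h2 : dist a' q < ε / 3 := hm
    have h3 : dist p' a' < ε / 3 := hn'
    have h4 : dist a p' < ε := by
      linarith [dist_triangle a q p', dist_triangle q a' p', dist_comm a' q, dist_comm p' a']
    rwa [sub_add_sub_cancel, ← dist_eq_norm]
  have hord : Φ (t (φ n)) (y (φ n)) - Φ (t (φ n)) x ∈ C :=
    hmono.monotone _ _ (hyC _) _ (ht _)
  have hfin := hεC (Φ (t (φ n)) x) (subset_closure (mem_forwardOrbit Φ x (ht _)))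
    _ hord (hyt _) _ hw
  rw [add_sub_cancel, ← Φ.map_add, ← Φ.map_add, add_comm (1 : ℝ)] at hfin
  -- At the time of `n`, the difference `p - a` lies in `C` with margin `ε`, and `a` is within `ε`
  -- of `p'`. Hence two points of one and the same orbit, that of `y (φ n)`, are distinct and
  -- ordered.
  have heq : p - a + (a - a' + (a' - p')) = p - p' := by abel
  rw [← hp, ← ha, heq] at hfin
  have hpp' : p ≠ p' := sub_ne_zero.1 hfin.2
  have hpo : p ∈ Φ.forwardOrbit (y (φ n)) := mem_forwardOrbit Φ _ (by linarith [ht (φ n)])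
  have hpo' : p' ∈ Φ.forwardOrbit (y (φ n)) := mem_forwardOrbit Φ _ (by linarith [ht (φ m)])
  refine ⟨fun heq => ?_, p, hpo, p', hpo', hpp', hfin.1⟩
  rw [heq] at hpo hpo'
  exact hpp' (hpo.trans hpo'.symm)

end Bounded

/-! ### Uniform expansion of the cone -/

section Expansion

variable {Φ : Flow ℝ V} {C : Set V} {k : ℕ} {K : Set V} {E F : V → Submodule ℝ V}

theorem IsExponentialSeparation.norm_spaceDeriv_mul_le
    (hEF : IsExponentialSeparation Φ C k K E F) :
    ∃ M γ : ℝ, 0 < M ∧ 0 < γ ∧ γ < 1 ∧ ∀ z ∈ K, ∀ f ∈ F z, ∀ e ∈ E z, ∀ t : ℝ, 0 ≤ t →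
      ‖e‖ * ‖spaceDeriv Φ t z f‖ ≤ M * γ ^ t * ‖spaceDeriv Φ t z e‖ * ‖f‖ := by
  obtain ⟨M, γ, hM, hγ0, hγ1, h⟩ := hEF.separation
  refine ⟨M, γ, hM, hγ0, hγ1, fun z hz f hf e he t ht => ?_⟩
  by_cases hf0 : f = 0
  · simp [hf0]
  by_cases he0 : e = 0
  · simp [he0]
  have hfp : 0 < ‖f‖ := norm_pos_iff.2 hf0
  have hep : 0 < ‖e‖ := norm_pos_iff.2 he0
  have hunit : ∀ v : V, v ≠ 0 → ‖‖v‖⁻¹ • v‖ = 1 := fun v hv => by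
    rw [norm_smul, norm_inv, norm_norm, inv_mul_cancel₀ (norm_ne_zero_iff.2 hv)]
  have := h z hz (‖f‖⁻¹ • f) ((F z).smul_mem _ hf) (hunit f hf0) (‖e‖⁻¹ • e)
    ((E z).smul_mem _ he) (hunit e he0) t ht
  rw [map_smul, map_smul, norm_smul, norm_smul, norm_inv, norm_inv, norm_norm, norm_norm] at this
  have h2 := mul_le_mul_of_nonneg_left this (mul_pos hfp hep).le
  field_simp at h2
  linarith

theorem IsExponentialSeparation.pow_mul_norm_le
    (h : ContDiff ℝ 1 (fun p : ℝ × V => Φ p.1 p.2)) (hinv : ∀ z ∈ K, ∀ t, Φ t z ∈ K)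
    (hEF : IsExponentialSeparation Φ C k K E F) {τ b : ℝ} (hτ : 0 < τ) (hb : 0 ≤ b)
    (hexp : ∀ z ∈ K, ∀ v ∈ E z, b * ‖v‖ ≤ ‖spaceDeriv Φ τ z v‖) (j : ℕ) :
    ∀ z ∈ K, ∀ v ∈ E z, b ^ j * ‖v‖ ≤ ‖spaceDeriv Φ (j * τ) z v‖ := by
  induction j with
  | zero => simp [spaceDeriv_zero_apply]
  | succ j ih =>
    intro z hz v hv
    have h1 : spaceDeriv Φ τ z v ∈ E (Φ τ z) := by
      rw [← hEF.map_E z hz τ hτ]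
      exact ⟨v, hv, rfl⟩
    have h2 := ih _ (hinv z hz τ) _ h1
    rw [← spaceDeriv_add_apply h] at h2
    push_cast
    rw [add_mul, one_mul]
    refine le_trans ?_ h2
    rw [pow_succ, mul_assoc]
    have := hexp z hz v hv
    gcongr

variable [FiniteDimensional ℝ V]

/-- Otherwise unit cone vectors with vanishing `E`-component would converge to a unit vector in some
`F z₀ ∩ C`, which is `{0}`. -/
theorem IsExponentialSeparation.exists_norm_le_component
    (hC : IsKCone k C) (hK : IsCompact K) (hEF : IsExponentialSeparation Φ C k K E F) :
    ∃ a > 0, ∀ z ∈ K, ∀ e ∈ E z, ∀ f ∈ F z, e + f ∈ C → a * ‖e + f‖ ≤ ‖e‖ := by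
  by_contra! hcon
  choose z hz e he f hf hC' hlt using fun n : ℕ => hcon (1 / ((n : ℝ) + 1)) (by positivity)
  have hpos : ∀ n, 0 < ‖e n + f n‖ := fun n => by
    have h1 := (norm_nonneg _).trans_lt (hlt n)
    exact pos_of_mul_pos_right h1 (by positivity)
  set s : ℕ → ℝ := fun n => ‖e n + f n‖⁻¹ with hs
  have hunit : ∀ n, ‖s n • (e n + f n)‖ = 1 := fun n => by
    rw [norm_smul, hs, norm_inv, norm_norm, inv_mul_cancel₀ (hpos n).ne']
  obtain ⟨⟨z₀, x₀⟩, ⟨hz₀, hx₀⟩, φ, hφ, hlim⟩ := (hK.prod (isCompact_sphere (0 : V) 1)).tendsto_subseq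
    (x := fun n => (z n, s n • (e n + f n))) fun n => ⟨hz n, by simpa using hunit n⟩
  have hzlim : Tendsto (fun n => z (φ n)) atTop (𝓝 z₀) :=
    (continuous_fst.tendsto _).comp hlim
  have hxlim : Tendsto (fun n => s (φ n) • (e (φ n) + f (φ n))) atTop (𝓝 x₀) :=
    (continuous_snd.tendsto _).comp hlim
  have helim : Tendsto (fun n => s n • e n) atTop (𝓝 0) := by
    refine squeeze_zero_norm (fun n => ?_) tendsto_one_div_add_atTop_nhds_zero_nat
    rw [norm_smul, hs, norm_inv, norm_norm, inv_mul_le_iff₀ (hpos n), mul_comm]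
    exact (hlt n).le
  have hflim : Tendsto (fun n => s (φ n) • f (φ n)) atTop (𝓝 x₀) := by
    have := hxlim.sub (helim.comp hφ.tendsto_atTop)
    simpa [smul_add] using this
  have hxF : x₀ ∈ F z₀ := hEF.bundle_F.hasClosedGraph _ z₀ (fun n => hz _) hz₀ hzlim _ x₀
    (fun n => (F _).smul_mem _ (hf _)) hflim
  have hxC : x₀ ∈ C := hC.isClosed.mem_of_tendsto hxlim
    (Eventually.of_forall fun n => hC.smul_mem _ (hC' _) _)
  have h0 : x₀ ∈ ({0} : Set V) := hEF.F_inter z₀ hz₀ ▸ ⟨hxF, hxC⟩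
  rw [Set.mem_singleton_iff.1 h0] at hx₀
  simp at hx₀

theorem IsExponentialSeparation.exists_expands_cone (h : ContDiff ℝ 1 (fun p : ℝ × V => Φ p.1 p.2))
    (hC : IsKCone k C) (hK : IsCompact K) (hinv : ∀ z ∈ K, ∀ t, Φ t z ∈ K)
    (hEF : IsExponentialSeparation Φ C k K E F) {τ b : ℝ} (hτ : 0 < τ) (hb : 1 < b)
    (hexp : ∀ z ∈ K, ∀ v ∈ E z, b * ‖v‖ ≤ ‖spaceDeriv Φ τ z v‖) :
    ∃ T > 0, ∀ z ∈ K, ∀ v ∈ C, 2 * ‖v‖ ≤ ‖spaceDeriv Φ T z v‖ := by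
  obtain ⟨a, ha, hcomp⟩ := hEF.exists_norm_le_component hC hK
  obtain ⟨M, γ, hM, hγ0, hγ1, hsep⟩ := hEF.norm_spaceDeriv_mul_le
  have hlim1 : Tendsto (fun j : ℕ => M * (1 / a + 1) * (γ ^ τ) ^ j) atTop (𝓝 0) := by
    simpa using (tendsto_pow_atTop_nhds_zero_of_lt_one (Real.rpow_nonneg hγ0.le τ)
      (Real.rpow_lt_one hγ0.le hγ1 hτ)).const_mul (M * (1 / a + 1))
  have hlim2 : Tendsto (fun j : ℕ => b ^ j) atTop atTop := tendsto_pow_atTop_atTop_of_one_lt hb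
  -- For such `j` the image of the `F`-component is at most half that of the `E`-component, and the
  -- latter has grown by `4 / a`; since it began with at least the fraction `a` of the norm, the
  -- total grows by `2`.
  obtain ⟨j, hj1, hj2, hj0⟩ := ((hlim1.eventually (gt_mem_nhds one_half_pos)).and
    ((hlim2.eventually_ge_atTop (4 / a)).and (eventually_gt_atTop 0))).exists
  have hj0' : (0 : ℝ) < j := by exact_mod_cast hj0
  refine ⟨j * τ, by positivity, fun z hz v hv => ?_⟩
  have htop : v ∈ E z ⊔ F z := by rw [(hEF.isCompl z hz).sup_eq_top]; trivial
  obtain ⟨e, he, f, hf, rfl⟩ := Submodule.mem_sup.1 htop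
  have h1 := hcomp z hz e he f hf hv
  have h2 := hEF.pow_mul_norm_le h hinv hτ (by linarith) hexp j z hz e he
  by_cases he0 : e = 0
  · rw [he0, norm_zero] at h1
    have : ‖e + f‖ = 0 := by
      rw [he0]
      nlinarith [norm_nonneg (0 + f)]
    rw [this, mul_zero]
    exact norm_nonneg _
  have hep : 0 < ‖e‖ := norm_pos_iff.2 he0
  have h3 := hsep z hz f hf e he (j * τ) (by positivity)
  have hγj : γ ^ ((j : ℝ) * τ) = (γ ^ τ) ^ j := by
    rw [mul_comm, Real.rpow_mul hγ0.le, Real.rpow_natCast]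
  rw [hγj] at h3
  have h4 : ‖f‖ ≤ (1 / a + 1) * ‖e‖ := by
    have h5 : ‖f‖ ≤ ‖e + f‖ + ‖e‖ := by simpa [add_comm] using norm_sub_le (e + f) e
    have h6 : ‖e + f‖ ≤ 1 / a * ‖e‖ := by
      rw [one_div_mul_eq_div, le_div_iff₀ ha]
      linarith
    linarith
  set q := (γ ^ τ) ^ j with hq
  have hq0 : 0 ≤ q := pow_nonneg (Real.rpow_nonneg hγ0.le τ) j
  have h7 : ‖spaceDeriv Φ (j * τ) z f‖ ≤ 1 / 2 * ‖spaceDeriv Φ (j * τ) z e‖ := by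
    refine le_of_mul_le_mul_left ?_ hep
    calc _ ≤ M * q * ‖spaceDeriv Φ (j * τ) z e‖ * ‖f‖ := h3
      _ ≤ M * q * ‖spaceDeriv Φ (j * τ) z e‖ * ((1 / a + 1) * ‖e‖) := by gcongr
      _ = (M * (1 / a + 1) * q) * (‖e‖ * ‖spaceDeriv Φ (j * τ) z e‖) := by ring
      _ ≤ 1 / 2 * (‖e‖ * ‖spaceDeriv Φ (j * τ) z e‖) := by gcongr
      _ = _ := by ring
  have h8 : ‖spaceDeriv Φ (j * τ) z e‖ - ‖spaceDeriv Φ (j * τ) z f‖ ≤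
      ‖spaceDeriv Φ (j * τ) z (e + f)‖ := by
    rw [map_add]
    have := norm_sub_le (spaceDeriv Φ (j * τ) z e + spaceDeriv Φ (j * τ) z f)
      (spaceDeriv Φ (j * τ) z f)
    rw [add_sub_cancel_right] at this
    linarith
  have h9 : 4 / a * (a * ‖e + f‖) ≤ b ^ j * ‖e‖ := by
    have hba : 0 < 4 / a := by positivity
    gcongr
  have h10 : 4 / a * (a * ‖e + f‖) = 4 * ‖e + f‖ := by field_simp
  linarith

/-- If the linearized flow over the limit set of a bounded orbit expands the cone, then nearby
points are pseudo-ordered. -/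
theorem FWW.mem_closure_pseudoOrdered_of_expands {x : V} (hΦ : FWW Φ C k)
    (hb : Bornology.IsBounded (Φ.forwardOrbit x)) {T : ℝ} (hT : 0 < T)
    (hexp : ∀ z ∈ omega Φ x, ∀ v ∈ C, 2 * ‖v‖ ≤ ‖spaceDeriv Φ T z v‖) :
    x ∈ closure (pseudoOrdered Φ C) := by
  by_contra hx
  have h := hΦ.contDiff
  have hK := isCompact_omega hb
  -- Near `z` the time-`T` map differs from its derivative by at most `1 / 2` in Lipschitz sense, so
  -- expansion by `2` on the cone leaves `3 / 2` for ordered pairs. Stability up to half a Lebesgue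
  -- number keeps both orbits in one such neighbourhood.
  have hex : ∀ z : V, ∃ U : Set V, IsOpen U ∧ z ∈ U ∧ ∀ a ∈ U, ∀ b ∈ U,
      ‖Φ T a - Φ T b - spaceDeriv Φ T z (a - b)‖ ≤ 1 / 2 * ‖a - b‖ := fun z => by
    obtain ⟨s, hs, hs'⟩ := (hasStrictFDerivAt_flow h T z).approximates_deriv_on_nhds
      (c := 1 / 2) (Or.inr (by norm_num))
    refine ⟨interior s, isOpen_interior, mem_interior_iff_mem_nhds.2 hs, fun a ha b hb => ?_⟩
    simpa using hs' a (interior_subset ha) b (interior_subset hb)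
  choose U hUo hzU hU using hex
  obtain ⟨δ, hδ, hleb⟩ := lebesgue_number_lemma_of_metric (c := fun z : omega Φ x => U z) hK
    (fun z => hUo z) fun z hz => Set.mem_iUnion.2 ⟨⟨z, hz⟩, hzU z⟩
  obtain ⟨ρ, hρ, hstab⟩ := stable_of_notMem_closure_pseudoOrdered hΦ.isKCone.isClosed
    hΦ.stronglyMonotone hb hx (half_pos hδ)
  obtain ⟨W, hWC, hWk⟩ := hΦ.isKCone.isGreatest.1
  have hWpos : 0 < Module.finrank ℝ W := hWk ▸ hΦ.isKCone.one_le
  obtain ⟨⟨v, hvW⟩, hv0⟩ := Module.finrank_pos_iff_exists_ne_zero.1 hWpos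
  have hv0' : 0 < ‖v‖ := norm_pos_iff.2 fun h0 => hv0 (Subtype.ext h0)
  set s := ρ / (2 * ‖v‖) with hs
  have hs0 : 0 < s := by positivity
  set y := x + s • v with hy
  have hyC : Ordered C y x := by
    rw [Ordered, hy, add_sub_cancel_left]
    exact hΦ.isKCone.smul_mem v (hWC hvW) s
  have hyn : ‖y - x‖ < ρ := by
    rw [hy, add_sub_cancel_left, norm_smul, Real.norm_of_nonneg hs0.le, hs]
    have : ρ / (2 * ‖v‖) * ‖v‖ = ρ / 2 := by field_simp
    linarith
  have hyx : y ≠ x := by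
    rw [hy, Ne, add_eq_left, smul_eq_zero, not_or]
    exact ⟨hs0.ne', norm_pos_iff.1 hv0'⟩
  have hev := eventually_mem_of_omega_subset hb (Metric.isOpen_thickening (δ := δ / 2)
    (E := omega Φ x)) (Metric.self_subset_thickening (half_pos hδ) _)
  obtain ⟨t₀, ht₀⟩ := eventually_atTop.1 (hev.and (eventually_ge_atTop 0))
  have hgrow : ∀ t ≥ t₀, 3 / 2 * ‖Φ t y - Φ t x‖ ≤ ‖Φ (T + t) y - Φ (T + t) x‖ := by
    intro t ht
    obtain ⟨hmem, htpos⟩ := ht₀ t ht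
    obtain ⟨z, hz, hzd⟩ := Metric.mem_thickening_iff.1 hmem
    obtain ⟨⟨z', hz'⟩, hball⟩ := hleb z hz
    have hclose := hstab y hyC hyn t htpos
    have h1 : Φ t x ∈ U z' := hball (by
      rw [Metric.mem_ball]
      linarith)
    have h2 : Φ t y ∈ U z' := hball (by
      rw [Metric.mem_ball]
      rw [← dist_eq_norm] at hclose
      linarith [dist_triangle (Φ t y) (Φ t x) z])
    have h3 := hU z' _ h2 _ h1
    have h4 := hexp z' hz' _ (hΦ.stronglyMonotone.monotone y x hyC t htpos)
    rw [Φ.map_add, Φ.map_add]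
    have h5 := norm_sub_norm_le (spaceDeriv Φ T z' (Φ t y - Φ t x)) (Φ T (Φ t y) - Φ T (Φ t x))
    rw [norm_sub_rev] at h3
    linarith
  have hpow : ∀ j : ℕ, (3 / 2 : ℝ) ^ j * ‖Φ t₀ y - Φ t₀ x‖ ≤
      ‖Φ (j * T + t₀) y - Φ (j * T + t₀) x‖ := by
    intro j
    induction j with
    | zero => simp
    | succ j ih =>
      have h1 := hgrow (j * T + t₀) (by
        have : 0 ≤ (j : ℝ) * T := by positivity
        linarith)
      have h2 : ((j + 1 : ℕ) : ℝ) * T + t₀ = T + (j * T + t₀) := by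
        push_cast
        ring
      rw [h2, pow_succ]
      linarith
  have hpos : 0 < ‖Φ t₀ y - Φ t₀ x‖ :=
    norm_pos_iff.2 (sub_ne_zero.2 fun h0 => hyx (flow_injective Φ t₀ h0))
  obtain ⟨j, hj⟩ := pow_unbounded_of_one_lt (δ / 2 / ‖Φ t₀ y - Φ t₀ x‖)
    (show (1 : ℝ) < 3 / 2 by norm_num)
  rw [div_lt_iff₀ hpos] at hj
  have h1 := hstab y hyC hyn (j * T + t₀) (by
    have h2 := (ht₀ t₀ le_rfl).2
    positivity)
  linarith [hpow j]

end Expansion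

end

section

variable {V : Type*} [NormedAddCommGroup V] [NormedSpace ℝ V]

/-! ### The infimum norm -/

theorem infNorm_mul_norm_le (A : V →L[ℝ] V) (L : Submodule ℝ V) {v : V} (hv : v ∈ L) :
    infNorm A L * ‖v‖ ≤ ‖A v‖ := by
  by_cases hv0 : v = 0
  · simp [hv0]
  have hn : 0 < ‖v‖ := norm_pos_iff.2 hv0
  have h : infNorm A L ≤ ‖A (‖v‖⁻¹ • v)‖ := csInf_le
    ⟨0, by
      rintro _ ⟨w, -, rfl⟩
      exact norm_nonneg _⟩
    ⟨_, ⟨L.smul_mem _ hv, by rw [norm_smul, norm_inv, norm_norm, inv_mul_cancel₀ hn.ne']⟩, rfl⟩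
  rw [map_smul, norm_smul, norm_inv, norm_norm, inv_mul_eq_div, le_div_iff₀ hn] at h
  exact h

theorem exists_norm_eq_infNorm [FiniteDimensional ℝ V] (A : V →L[ℝ] V) {L : Submodule ℝ V}
    (hL : 0 < Module.finrank ℝ L) : ∃ v ∈ L, ‖v‖ = 1 ∧ ‖A v‖ = infNorm A L := by
  obtain ⟨⟨u, hu⟩, hu0⟩ := Module.finrank_pos_iff_exists_ne_zero.1 hL
  have hu0' : u ≠ 0 := fun h => hu0 (Subtype.ext h)
  have hne : ({v | v ∈ L ∧ ‖v‖ = 1} : Set V).Nonempty := ⟨‖u‖⁻¹ • u, L.smul_mem _ hu, by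
    rw [norm_smul, norm_inv, norm_norm, inv_mul_cancel₀ (norm_ne_zero_iff.2 hu0')]⟩
  have hcpt : IsCompact ({v | v ∈ L ∧ ‖v‖ = 1} : Set V) := by
    have : ({v | v ∈ L ∧ ‖v‖ = 1} : Set V) = (L : Set V) ∩ Metric.sphere 0 1 := by
      ext v
      simp
    rw [this]
    exact (isCompact_sphere _ _).inter_left (Submodule.closed_of_finiteDimensional L)
  obtain ⟨v, hv, hmin⟩ := (hcpt.image (f := fun v => ‖A v‖) (by fun_prop)).sInf_mem
    (hne.image _)
  exact ⟨v, hv.1, hv.2, hmin⟩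

/-! ### Growth of the infimum norm: uniform expansion or a slow regular point -/

section Growth

variable {Φ : Flow ℝ V} {C : Set V} {k : ℕ} {K : Set V} {E F : V → Submodule ℝ V}

/-- The logarithm of the infimum norm of `D_zΦ_t` on `E_z`. -/
noncomputable def logInfNorm (Φ : Flow ℝ V) (E : V → Submodule ℝ V) (t : ℝ) (z : V) : ℝ :=
  Real.log (infNorm (spaceDeriv Φ t z) (E z))

variable [FiniteDimensional ℝ V]

theorem infNorm_spaceDeriv_pos (h : ContDiff ℝ 1 (fun p : ℝ × V => Φ p.1 p.2))
    {z : V} {L : Submodule ℝ V} (hL : 0 < Module.finrank ℝ L) (t : ℝ) :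
    0 < infNorm (spaceDeriv Φ t z) L := by
  obtain ⟨v, -, hv1, hv⟩ := exists_norm_eq_infNorm (spaceDeriv Φ t z) hL
  rw [← hv]
  refine norm_pos_iff.2 fun h0 => ?_
  rw [eq_zero_of_spaceDeriv_eq_zero h h0, norm_zero] at hv1
  exact zero_ne_one hv1

theorem logInfNorm_zero {z : V} (hL : 0 < Module.finrank ℝ (E z)) : logInfNorm Φ E 0 z = 0 := by
  obtain ⟨v, -, hv1, hv⟩ := exists_norm_eq_infNorm (spaceDeriv Φ 0 z) hL
  rw [logInfNorm, ← hv, spaceDeriv_zero_apply, hv1, Real.log_one]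

theorem logInfNorm_add_le (h : ContDiff ℝ 1 (fun p : ℝ × V => Φ p.1 p.2))
    {z : V} (hL : 0 < Module.finrank ℝ (E z)) {M s t : ℝ}
    (hM : ∀ v, ‖spaceDeriv Φ s (Φ t z) v‖ ≤ M * ‖v‖) (hM0 : 0 < M) :
    logInfNorm Φ E (s + t) z ≤ Real.log M + logInfNorm Φ E t z := by
  obtain ⟨v, hv, hv1, hvm⟩ := exists_norm_eq_infNorm (spaceDeriv Φ t z) hL
  rw [logInfNorm, logInfNorm, ← Real.log_mul hM0.ne' (infNorm_spaceDeriv_pos h hL t).ne']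
  refine Real.log_le_log (infNorm_spaceDeriv_pos h hL _) ?_
  have h1 := infNorm_mul_norm_le (spaceDeriv Φ (s + t) z) (E z) hv
  rw [hv1, mul_one, spaceDeriv_add_apply h] at h1
  rw [← hvm]
  exact h1.trans (hM _)

/-- Superadditivity: `E` is carried onto `E`, so a vector minimizing over the long time is, after
time `t`, a test vector for the remaining time. -/
theorem add_logInfNorm_le (h : ContDiff ℝ 1 (fun p : ℝ × V => Φ p.1 p.2))
    (hEF : IsExponentialSeparation Φ C k K E F) (hk : 1 ≤ k) (hinv : ∀ z ∈ K, ∀ t, Φ t z ∈ K)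
    {z : V} (hz : z ∈ K) {t : ℝ} (ht : 0 ≤ t) (s : ℝ) :
    logInfNorm Φ E t z + logInfNorm Φ E s (Φ t z) ≤ logInfNorm Φ E (s + t) z := by
  have hd : ∀ y ∈ K, 0 < Module.finrank ℝ (E y) := fun y hy => by
    rw [hEF.bundle_E.finrank_eq y hy]
    exact hk
  rcases ht.eq_or_lt with rfl | ht
  · rw [logInfNorm_zero (hd z hz), Φ.map_zero_apply, add_zero, zero_add]
  obtain ⟨v, hv, hv1, hvm⟩ := exists_norm_eq_infNorm (spaceDeriv Φ (s + t) z) (hd z hz)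
  have hv' : spaceDeriv Φ t z v ∈ E (Φ t z) := by
    rw [← hEF.map_E z hz t ht]
    exact ⟨v, hv, rfl⟩
  have h1 := infNorm_mul_norm_le (spaceDeriv Φ t z) (E z) hv
  have h2 := infNorm_mul_norm_le (spaceDeriv Φ s (Φ t z)) (E (Φ t z)) hv'
  rw [← spaceDeriv_add_apply h, hvm] at h2
  rw [hv1, mul_one] at h1
  have hp1 := infNorm_spaceDeriv_pos h (z := z) (hd z hz) t
  have hp2 := infNorm_spaceDeriv_pos h (z := Φ t z) (hd _ (hinv z hz t)) s
  rw [logInfNorm, logInfNorm, logInfNorm, ← Real.log_mul hp1.ne' hp2.ne']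
  refine Real.log_le_log (mul_pos hp1 hp2) ?_
  rw [mul_comm]
  refine le_trans ?_ h2
  gcongr

/-- Upper bounds for the infimum norm pass to limits of base points. -/
theorem logInfNorm_le_of_tendsto (h : ContDiff ℝ 1 (fun p : ℝ × V => Φ p.1 p.2))
    (hE : HasClosedGraph K E) (hd : ∀ z ∈ K, 0 < Module.finrank ℝ (E z)) {z : ℕ → V} {z₀ : V}
    (hz : ∀ j, z j ∈ K) (hz₀ : z₀ ∈ K) (hlim : Tendsto z atTop (𝓝 z₀)) {t : ℝ} {c : ℕ → ℝ}
    {c₀ : ℝ} (hc : Tendsto c atTop (𝓝 c₀)) (hle : ∀ᶠ j in atTop, logInfNorm Φ E t (z j) ≤ c j) :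
    logInfNorm Φ E t z₀ ≤ c₀ := by
  choose v hv hv1 hvm using fun j => exists_norm_eq_infNorm (spaceDeriv Φ t (z j)) (hd _ (hz j))
  obtain ⟨v₀, hv₀, φ, hφ, hvlim⟩ := (isCompact_sphere (0 : V) 1).tendsto_subseq
    (x := v) fun j => by simpa using hv1 j
  have hzφ := hlim.comp hφ.tendsto_atTop
  have hv₀E : v₀ ∈ E z₀ := hE _ z₀ (fun j => hz (φ j)) hz₀ hzφ _ v₀ (fun j => hv (φ j)) hvlim
  have h1 := infNorm_mul_norm_le (spaceDeriv Φ t z₀) (E z₀) hv₀E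
  have hv₀1 : ‖v₀‖ = 1 := by simpa using hv₀
  rw [hv₀1, mul_one] at h1
  have h2 : ‖spaceDeriv Φ t z₀ v₀‖ ≤ Real.exp c₀ := by
    refine le_of_tendsto_of_tendsto (tendsto_spaceDeriv_apply h t hzφ hvlim).norm
      ((Real.continuous_exp.tendsto c₀).comp (hc.comp hφ.tendsto_atTop)) ?_
    filter_upwards [hφ.tendsto_atTop.eventually hle] with j hj
    have := Real.exp_le_exp.2 hj
    rwa [logInfNorm, Real.exp_log (infNorm_spaceDeriv_pos h (hd _ (hz _)) t), ← hvm] at this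
  rw [logInfNorm, Real.log_le_iff_le_exp (infNorm_spaceDeriv_pos h (hd _ hz₀) t)]
  exact h1.trans h2

/-- A superadditive cocycle that is slow over a long time has a shift that is slow at all times of
a prescribed range. -/
theorem exists_slow_shift {X : Type*} (T : X → X) (f : ℕ → X → ℝ) {β ε Λ : ℝ} (hε : 0 < ε)
    (hΛ : 0 ≤ Λ)
    (hf : ∀ m n x, f m x + f n (T^[m] x) ≤ f (m + n) x)
    (hlow : ∀ n x, -(Λ * n) ≤ f n x) (hslow : ∀ n : ℕ, ∃ x, f n x ≤ β * n + 1) (N : ℕ) :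
    ∃ x, ∀ j ≤ N, f j x ≤ (β + ε) * j := by
  obtain ⟨n, hn⟩ := exists_nat_gt (((Λ + |β| + ε) * N + 1) / ε)
  rw [div_lt_iff₀ hε] at hn
  obtain ⟨x, hx⟩ := hslow n
  -- `B s` is the excess of the remaining stretch, from `s` to `n`, over slope `β + ε`. Where it is
  -- minimal, superadditivity forces every initial piece to be slow. The minimum is at most `1 - ε
  -- n`, so the remaining stretch is long, and `n` was chosen to make it at least `N`.
  set B : ℕ → ℝ := fun s => f (n - s) (T^[s] x) - (β + ε) * ((n - s : ℕ) : ℝ) with hB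
  obtain ⟨s, hs, hmin⟩ := (Finset.range (n + 1)).exists_min_image B ⟨0, by simp⟩
  have hsn : s ≤ n := Nat.lt_succ_iff.1 (Finset.mem_range.1 hs)
  have h0 := hmin 0 (by simp)
  have hB0 : B 0 ≤ 1 - ε * n := by
    simp only [hB, Nat.sub_zero, Function.iterate_zero, id]
    linarith
  have hBs : -((Λ + |β| + ε) * ((n - s : ℕ) : ℝ)) ≤ B s := by
    have h1 := hlow (n - s) (T^[s] x)
    have h2 : β * ((n - s : ℕ) : ℝ) ≤ |β| * ((n - s : ℕ) : ℝ) := by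
      gcongr
      exact le_abs_self β
    simp only [hB]
    linarith
  have hNs : N ≤ n - s := by
    by_contra hlt
    push Not at hlt
    have h1 : (((n - s : ℕ) : ℝ)) ≤ N := by exact_mod_cast hlt.le
    have h2 : (Λ + |β| + ε) * ((n - s : ℕ) : ℝ) ≤ (Λ + |β| + ε) * N := by
      have := abs_nonneg β
      gcongr
    linarith
  refine ⟨T^[s] x, fun j hj => ?_⟩
  have hsj := hmin (s + j) (Finset.mem_range.2 (by omega))
  have hsup := hf j (n - (s + j)) (T^[s] x)
  rw [← Function.iterate_add_apply, show j + (n - (s + j)) = n - s by omega, add_comm j s] at hsup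
  simp only [hB] at hsj
  have hcast : ((n - s : ℕ) : ℝ) = ((n - (s + j) : ℕ) : ℝ) + j := by
    rw [← Nat.cast_add]
    congr 1
    omega
  rw [hcast] at hsj
  linarith

/-- Either the linearized flow expands `E` uniformly over `K`, or there is a regular point whose
exponent is not positive. -/
theorem IsExponentialSeparation.expands_or_exists_regular
    (h : ContDiff ℝ 1 (fun p : ℝ × V => Φ p.1 p.2)) (hK : IsCompact K)
    (hinv : ∀ z ∈ K, ∀ t, Φ t z ∈ K) (hk : 1 ≤ k)
    (hEF : IsExponentialSeparation Φ C k K E F) :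
    (∃ n : ℕ, 0 < n ∧ ∀ z ∈ K, ∀ v ∈ E z, 2 * ‖v‖ ≤ ‖spaceDeriv Φ n z v‖) ∨
      ∃ z ∈ K, IsRegular Φ E z ∧ lyapunov Φ E z ≤ 0 := by
  rcases K.eq_empty_or_nonempty with rfl | hne
  · exact Or.inl ⟨1, one_pos, fun z hz => absurd hz (Set.notMem_empty z)⟩
  have hd : ∀ y ∈ K, 0 < Module.finrank ℝ (E y) := fun y hy => by
    rw [hEF.bundle_E.finrank_eq y hy]
    exact hk
  obtain ⟨M, hM1, hM⟩ := exists_norm_spaceDeriv_le h hK 1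
  have hM0 : 0 < M := one_pos.trans_le hM1
  set Λ := Real.log M with hΛ
  have hΛ0 : 0 ≤ Λ := Real.log_nonneg hM1
  set f : ℝ → V → ℝ := logInfNorm Φ E with hf
  have hup : ∀ z ∈ K, ∀ s t, |s| ≤ 1 → f (s + t) z ≤ Λ + f t z := fun z hz s t hs =>
    logInfNorm_add_le h (hd z hz) (hM _ (hinv z hz t) s hs) hM0
  have hf0 : ∀ z ∈ K, f 0 z = 0 := fun z hz => logInfNorm_zero (hd z hz)
  have hbound : ∀ (n : ℕ), ∀ z ∈ K, -(Λ * n) ≤ f n z ∧ f n z ≤ Λ * n := by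
    intro n z hz
    induction n with
    | zero => simp [hf0 z hz]
    | succ n ih =>
      have h1 := hup z hz 1 n (by simp)
      have h2 := hup z hz (-1) (1 + n) (by simp)
      rw [neg_add_cancel_left] at h2
      push_cast
      rw [add_comm (n : ℝ)]
      constructor <;> linarith
  set b : ℕ → ℝ := fun n => sInf (f n '' K) with hb
  have hbdd : ∀ n : ℕ, BddBelow (f n '' K) := fun n => ⟨-(Λ * n), by
    rintro _ ⟨z, hz, rfl⟩
    exact (hbound n z hz).1⟩
  have hble : ∀ (n : ℕ), ∀ z ∈ K, b n ≤ f n z := fun n z hz => csInf_le (hbdd n) ⟨z, hz, rfl⟩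
  have hsub : Subadditive fun n => -b n := by
    intro m n
    have : b m + b n ≤ b (m + n) := by
      refine le_csInf (hne.image _) ?_
      rintro _ ⟨z, hz, rfl⟩
      have h1 := add_logInfNorm_le h hEF hk hinv hz (Nat.cast_nonneg m) (n : ℝ)
      push_cast
      rw [add_comm (m : ℝ)]
      linarith [hble m z hz, hble n _ (hinv z hz m)]
    linarith
  have hubdd : BddBelow (Set.range fun n : ℕ => -b n / n) := by
    refine ⟨-Λ, ?_⟩
    rintro _ ⟨n, rfl⟩
    rcases n.eq_zero_or_pos with rfl | hn
    · simpa using hΛ0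
    obtain ⟨z, hz⟩ := hne
    have hn' : (0 : ℝ) < n := by exact_mod_cast hn
    show -Λ ≤ -b n / n
    rw [le_div_iff₀ hn']
    linarith [hble n z hz, (hbound n z hz).2]
  set β := -hsub.lim with hβ
  have hblim : Tendsto (fun n : ℕ => b n / n) atTop (𝓝 β) := by
    have := (hsub.tendsto_lim hubdd).neg
    refine this.congr fun n => ?_
    ring
  rcases lt_or_ge 0 β with hpos | hneg
  · left
    have h1 := hblim.eventually (lt_mem_nhds (half_lt_self hpos))
    obtain ⟨n, hn1, hn2, hn0⟩ := (h1.and ((tendsto_natCast_atTop_atTop.eventually_ge_atTop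
      (Real.log 2 / (β / 2))).and (eventually_gt_atTop 0))).exists
    have hn' : (0 : ℝ) < n := by exact_mod_cast hn0
    rw [lt_div_iff₀ hn'] at hn1
    rw [div_le_iff₀ (half_pos hpos)] at hn2
    refine ⟨n, hn0, fun z hz v hv => le_trans ?_ (infNorm_mul_norm_le _ _ hv)⟩
    have h2 : Real.log 2 ≤ Real.log (infNorm (spaceDeriv Φ n z) (E z)) := by
      have : f n z = Real.log (infNorm (spaceDeriv Φ n z) (E z)) := rfl
      rw [← this]
      linarith [hble n z hz]
    have h3 := (Real.log_le_log_iff two_pos (infNorm_spaceDeriv_pos h (hd z hz) n)).1 h2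
    gcongr
  · right
    -- By Fekete's lemma the limit `β` is also the supremum of the quotients `b n / n`.
    have hbβ : ∀ n : ℕ, b n ≤ β * n := fun n => by
      rcases n.eq_zero_or_pos with rfl | hn
      · obtain ⟨z, hz⟩ := hne
        simpa [hf0 z hz] using hble 0 z hz
      have hn' : (0 : ℝ) < n := by exact_mod_cast hn
      have := hsub.lim_le_div hubdd hn.ne'
      rw [le_div_iff₀ hn'] at this
      linarith
    have hshift : ∀ N : ℕ, ∃ y : K, ∀ j ≤ N, f j y ≤ (β + 1 / ((N : ℝ) + 1)) * j := by
      intro N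
      have hiter : ∀ (m : ℕ) (y : K), (((fun y : K => (⟨Φ 1 y, hinv y y.2 1⟩ : K))^[m] y : K) : V) =
          Φ m y := by
        intro m
        induction m with
        | zero => simp
        | succ m ih =>
          intro y
          rw [Function.iterate_succ_apply, ih, ← Φ.map_add]
          push_cast
          rfl
      refine exists_slow_shift (fun y : K => (⟨Φ 1 y, hinv y y.2 1⟩ : K))
        (fun n y => f n y) (Λ := Λ) (by positivity) hΛ0 (fun m n y => ?_)
        (fun n y => (hbound n y y.2).1) (fun n => ?_) N
      · have := add_logInfNorm_le h hEF hk hinv y.2 (Nat.cast_nonneg m) (n : ℝ)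
        rw [hiter]
        push_cast
        rwa [add_comm (m : ℝ)]
      · obtain ⟨_, ⟨z, hz, rfl⟩, hlt⟩ := exists_lt_of_csInf_lt (hne.image (f n))
          (show sInf (f n '' K) < β * n + 1 by linarith [hbβ n])
        exact ⟨⟨z, hz⟩, hlt.le⟩
    choose y hy using hshift
    obtain ⟨y₀, hy₀, φ, hφ, hylim⟩ := hK.tendsto_subseq (x := fun N => (y N : V)) fun N => (y N).2
    -- Each `j` is eventually below `φ N`, so the slow bounds with slopes tending to `β` pass to the
    -- limit point at all times simultaneously.
    have hfy : ∀ j : ℕ, f j y₀ ≤ β * j := fun j => by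
      have hc : Tendsto (fun N => (β + 1 / ((φ N : ℝ) + 1)) * j) atTop (𝓝 (β * j)) := by
        have h1 := (tendsto_one_div_add_atTop_nhds_zero_nat (𝕜 := ℝ)).comp hφ.tendsto_atTop
        simpa using (h1.const_add β).mul_const (j : ℝ)
      refine logInfNorm_le_of_tendsto h hEF.bundle_E.hasClosedGraph hd (fun N => (y (φ N)).2) hy₀
        hylim hc ?_
      filter_upwards [eventually_ge_atTop j] with N hN
      exact hy (φ N) j (hN.trans (hφ.id_le N))
    -- The infimum `b n` bounds `f n y₀` from below and `β n` from above, and both have slope `β`;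
    -- this squeeze is what makes `y₀` regular.
    have hnat : Tendsto (fun n : ℕ => f n y₀ / n) atTop (𝓝 β) := by
      refine tendsto_of_tendsto_of_tendsto_of_le_of_le' hblim tendsto_const_nhds ?_ ?_
      · filter_upwards with n
        have := hble n y₀ hy₀
        gcongr
      · filter_upwards [eventually_gt_atTop 0] with n hn
        have hn' : (0 : ℝ) < n := by exact_mod_cast hn
        rw [div_le_iff₀ hn']
        exact hfy n
    have hreal : Tendsto (fun t : ℝ => f t y₀ / t) atTop (𝓝 β) := by
      have h1 : Tendsto (fun t : ℝ => f (⌊t⌋₊ : ℕ) y₀ / (⌊t⌋₊ : ℕ) * ((⌊t⌋₊ : ℕ) / t)) atTop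
          (𝓝 β) := by
        simpa using (hnat.comp tendsto_nat_floor_atTop).mul (tendsto_nat_floor_div_atTop (R := ℝ))
      have h2 : Tendsto (fun t : ℝ => Λ / t) atTop (𝓝 0) := tendsto_const_nhds.div_atTop tendsto_id
      have h3 : ∀ᶠ t : ℝ in atTop, |f t y₀ - f (⌊t⌋₊ : ℕ) y₀| ≤ Λ := by
        filter_upwards [eventually_ge_atTop 0] with t ht
        have hle := Nat.floor_le ht
        have hlt := Nat.lt_floor_add_one t
        have h4 := hup y₀ hy₀ (t - (⌊t⌋₊ : ℕ)) (⌊t⌋₊ : ℕ) (by rw [abs_le]; constructor <;> linarith)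
        have h5 := hup y₀ hy₀ ((⌊t⌋₊ : ℕ) - t) t (by rw [abs_le]; constructor <;> linarith)
        rw [sub_add_cancel] at h4 h5
        rw [abs_le]
        constructor <;> linarith
      have h6 : Tendsto (fun t : ℝ => (f t y₀ - f (⌊t⌋₊ : ℕ) y₀) / t) atTop (𝓝 0) := by
        refine squeeze_zero_norm' ?_ h2
        filter_upwards [h3, eventually_gt_atTop 0] with t ht ht0
        rw [Real.norm_eq_abs, abs_div, abs_of_pos ht0]
        gcongr
      have h7 := h6.add h1
      rw [zero_add] at h7
      refine h7.congr' ?_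
      filter_upwards [eventually_ge_atTop 1] with t ht
      have hfl : (0 : ℝ) < (⌊t⌋₊ : ℕ) := by exact_mod_cast Nat.floor_pos.2 ht
      field_simp
      ring
    have hlim : Tendsto (growthRate Φ E y₀) atTop (𝓝 (β : EReal)) :=
      (continuous_coe_real_ereal.tendsto β).comp hreal
    have hly : lyapunov Φ E y₀ = β := hlim.limsup_eq
    refine ⟨y₀, hy₀, ?_, ?_⟩
    · rw [IsRegular, hly]
      exact hlim
    · rw [hly]
      exact_mod_cast hneg

end Growth

/-- If all regular points of the limit set have a positive exponent, then the point is a limit of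
pseudo-ordered points. -/
theorem FWW.mem_closure_pseudoOrdered_of_lyapunov_pos [FiniteDimensional ℝ V] {Φ : Flow ℝ V}
    {C : Set V} {k : ℕ} (hΦ : FWW Φ C k) {x : V} (hb : Bornology.IsBounded (Φ.forwardOrbit x))
    {E F : V → Submodule ℝ V} (hEF : IsExponentialSeparation Φ C k (omega Φ x) E F)
    (hpos : ∀ z ∈ regularOmega Φ E x, 0 < lyapunov Φ E z) : x ∈ closure (pseudoOrdered Φ C) := by
  have hK := isCompact_omega hb
  have hinv := omega_invariant Φ x
  rcases hEF.expands_or_exists_regular hΦ.contDiff hK hinv hΦ.isKCone.one_le with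
    ⟨n, hn, hexp⟩ | ⟨z, hz, hreg, hle⟩
  · obtain ⟨T, hT, hexpC⟩ := hEF.exists_expands_cone hΦ.contDiff hΦ.isKCone hK hinv
      (Nat.cast_pos.2 hn) one_lt_two hexp
    exact hΦ.mem_closure_pseudoOrdered_of_expands hb hT hexpC
  · exact absurd (hpos z ⟨hz, hreg⟩) (not_lt.2 hle)

end

end ConeFlow

theorem theorem4p6 {V : Type*} [NormedAddCommGroup V] [NormedSpace ℝ V] [FiniteDimensional ℝ V]
    (Φ : Flow ℝ V) (C : Set V) (k : ℕ) (hΦ : FWW Φ C k)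
    (D : Set V) (hD : IsOpen D) (hDω : OmegaCompact Φ D) (x : V) (hx : x ∈ D) :
    (∃ E F : V → Submodule ℝ V, IsExponentialSeparation Φ C k (omega Φ x) E F) ∧
    ∀ E F : V → Submodule ℝ V, IsExponentialSeparation Φ C k (omega Φ x) E F →
      (∀ z ∈ regularOmega Φ E x, 0 < lyapunov Φ E z) →
      (∃ z ∈ omega Φ x \ regularOmega Φ E x, lyapunov Φ E z ≤ 0) →
      x ∈ closure (pseudoOrdered Φ C) :=
  ⟨hΦ.exists_isExponentialSeparation (isCompact_omega (hDω.1 x hx)) (omega_invariant Φ x),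
    fun _ _ hEF hpos _ => hΦ.mem_closure_pseudoOrdered_of_lyapunov_pos (hDω.1 x hx) hEF hpos⟩
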